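/- A block MDP (BMDP) $\Phi=(p,q,f)$ has $S$ latent states, $A$ actions, $n$ contexts $x\in\mathcal X$, a decoding function $f:\mathcal X\to\mathcal S$, latent dynamics $p(s'|s,a)$, emission distributions $q(\cdot|s)$ with support $f^{-1}(s)$, and the uniform distribution as law of the initial context; the next context after $(x,a)$ is drawn by $s'\sim p(\cdot|f(x),a)$, then $x'\sim q(\cdot|s')$. Episodes have $H\ge2$ stages. Rewards are functions $r_h(x,a)\in[0,1]$, policies are collections of $H$ maps from contexts to distributions over actions, $V^\pi(r)$ is the expected total reward of an episode played with $\pi$, and $V^\star(r)=\sup_\pi V^\pi(r)$. Let $$\Lambda(\Phi)=\max_{v\in[-1,1]^S}\frac1S\sum_{s}\max_{a_1,a_2}\sum_{s'}\bigl(p(s'|s,a_1)-p(s'|s,a_2)\bigr)v_{s'} .$$ For $\eta>1$, call $\Phi$ $\eta$-regular if there are $\alpha_s>0$ with $\sum_s\alpha_s=1$, $|f^{-1}(s)|=\alpha_sn$ and $\alpha_{s_1}\le\eta\,\alpha_{s_2}$; $p(s_2|s_1,a)\le\eta\,p(s_3|s_1,a)$ and $p(s_1|s_2,a)\le\eta\,p(s_1|s_3,a)$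 for all $s_1,s_2,s_3,a$; and $q(x|s)\le\eta\,q(y|s)$ for all $s$ and $x,y\in f^{-1}(s)$. **Theorem.** For all $S$, $A$, $\eta>1$ and $\lambda>0$ there are constants $c,K,\varepsilon_0>0$ and $n_0$, depending only on $(S,A,\eta,\lambda)$, such that the following holds for every $n\ge n_0$, every $\eta$-regular BMDP $\Phi=(p,q,f)$ with $S$ latent states, $A$ actions, $n$ contexts and $\Lambda(\Phi)\ge\lambda$, all $H\ge2$, $T\ge 0$ and $0<\varepsilon\le\varepsilon_0$. Consider any (possibly randomized) algorithm that observes $T$ episodes of length $H$, choosing each action from a distribution that may depend on all past observations and on the current context, and that then outputs a policy $\hat\pi_r$ for every reward function $r$. If $$\sup_r\frac1H\bigl(V^\star(r)-V^{\hat\pi_r}(r)\bigr)\le\varepsilon\quad\text{with probability at least }1/2$$ under every $\eta$-regular BMDP $\tilde\Phi=(p,\tilde q,f)$ with $\max_{s,x}|\tilde q(x|s)-q(x|s)|\le K\varepsilon/n$ (values $V^\star$, $V^{\hat\pi_r}$ and probability being those of $\tilde\Phi$), then $$TH\ \ge\ c\,\frac{n\,\Lambda(\Phi)}{\varepsilon^2}.$$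 -/

import Mathlib

open scoped ENNReal

noncomputable section

/-- A Block MDP with latent states `S`, actions `A` and contexts `X`: the law `μ` of the initial
context, the latent dynamics `p(· | s, a)`, the emission distributions `q(· | s)` and the decoding
function `f`. The support of `q(· | s)` is the cluster `f⁻¹(s)`. -/
structure BMDP (S A X : Type*) where
  μ : PMF X
  p : S → A → PMF S
  q : S → PMF X
  f : X → S
  support_q : ∀ s, (q s).support = f ⁻¹' {s}

/-- Non-stationary rewards `r_h(x, a) ∈ [0, 1]`, for the stages `h = 0, …, H - 1`. -/
abbrev Reward (A X : Type*) (H : ℕ) : Type _ := Fin H → X → A → Set.Icc (0 : ℝ) 1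

/-- A policy: one map from contexts to distributions over actions for each of the `H` stages. -/
abbrev Policy (A X : Type*) (H : ℕ) : Type _ := Fin H → X → PMF A

namespace BMDP

variable {S A X : Type*}

/-- The law of the next context when action `a` is played in context `x`: the latent state moves
from `f x` to `s' ∼ p(· | f x, a)`, then a context is drawn from `q(· | s')`. -/
def step (Φ : BMDP S A X) (x : X) (a : A) : PMF X :=
  (Φ.p (Φ.f x) a).bind Φ.q

/-- The law of the (context, action) pair of stage `h` of an episode played with `π`. -/
def stageLaw (Φ : BMDP S A X) {H : ℕ} (π : Policy A X H) : (h : ℕ) → h < H → PMF (X × A)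
  | 0, hh => Φ.μ.bind fun x => (π ⟨0, hh⟩ x).map fun a => (x, a)
  | h + 1, hh =>
      (stageLaw Φ π h (Nat.lt_of_succ_lt hh)).bind fun z =>
        (Φ.step z.1 z.2).bind fun x => (π ⟨h + 1, hh⟩ x).map fun a => (x, a)

/-- The value `V^π(r)`: the expected total reward of an episode played with `π`. -/
def value [Fintype A] [Fintype X] (Φ : BMDP S A X) {H : ℕ} (r : Reward A X H)
    (π : Policy A X H) : ℝ :=
  ∑ h : Fin H, ∑ z : X × A, (Φ.stageLaw π h h.2 z).toReal * (r h z.1 z.2 : ℝ)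

/-- The optimal value `V^⋆(r)`. -/
def optValue [Fintype A] [Fintype X] (Φ : BMDP S A X) {H : ℕ} (r : Reward A X H) : ℝ :=
  ⨆ π : Policy A X H, Φ.value r π

/-- `Λ(Φ) = max_{v ∈ [-1,1]^S} (1/S) ∑_s max_{a₁,a₂} ∑_{s'} (p(s'|s,a₁) - p(s'|s,a₂)) v_{s'}`. -/
def Lam [Fintype S] (Φ : BMDP S A X) : ℝ :=
  ⨆ v : S → Set.Icc (-1 : ℝ) 1,
    (1 / (Fintype.card S : ℝ)) * ∑ s : S, ⨆ a : A × A,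
      ∑ s' : S, ((Φ.p s a.1 s').toReal - (Φ.p s a.2 s').toReal) * (v s' : ℝ)

/-- Linear cluster sizes: `|f⁻¹(s)| = α_s n` with `α_s > 0` and `∑_s α_s = 1`. -/
def LinearClusters [Fintype S] [Fintype X] (Φ : BMDP S A X) (α : S → ℝ) : Prop :=
  (∀ s, 0 < α s) ∧ ∑ s, α s = 1 ∧
    ∀ s, ((Φ.f ⁻¹' {s}).ncard : ℝ) = α s * (Fintype.card X : ℝ)

/-- `η`-regularity of the cluster proportions, of the latent dynamics and of the emissions; the
conditions on ratios are written without division. -/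
def Regular (Φ : BMDP S A X) (α : S → ℝ) (η : ℝ) : Prop :=
  (∀ s₁ s₂, α s₁ ≤ η * α s₂) ∧
  (∀ a s₁ s₂ s₃, (Φ.p s₁ a s₂).toReal ≤ η * (Φ.p s₁ a s₃).toReal ∧
    (Φ.p s₂ a s₁).toReal ≤ η * (Φ.p s₃ a s₁).toReal) ∧
  (∀ s x y, Φ.f x = s → Φ.f y = s → (Φ.q s x).toReal ≤ η * (Φ.q s y).toReal)

/-- The initial context is uniform. -/
def UniformInit [Fintype X] (Φ : BMDP S A X) : Prop :=
  ∀ x, (Φ.μ x).toReal = 1 / (Fintype.card X : ℝ)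

/-- The map `r ↦ π̂_r` satisfies `sup_r (1/H) (V^⋆(r) - V^{π̂_r}(r)) ≤ ε` for the BMDP `Φ`. -/
def UniformlyNearOptimal [Fintype A] [Fintype X] (Φ : BMDP S A X) {H : ℕ}
    (pol : Reward A X H → Policy A X H) (ε : ℝ) : Prop :=
  ∀ r : Reward A X H, (1 / (H : ℝ)) * (Φ.optValue r - Φ.value r (pol r)) ≤ ε

/-- The law of the next observed context given the list of all (context, action) pairs observed so
far, over all episodes, the most recent first: episodes have length `H`, so a new one starts
whenever the number of past observations is a multiple of `H`. -/
def nextContext (Φ : BMDP S A X) (H : ℕ) : List (X × A) → PMF X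
  | [] => Φ.μ
  | z :: past => if H ∣ past.length + 1 then Φ.μ else Φ.step z.1 z.2

/-- The law of the first `k` observations when the action played in context `x` after the past
`w` is drawn from `explore w x` (adaptive exploration). -/
def dataLaw (Φ : BMDP S A X) (H : ℕ) (explore : List (X × A) → X → PMF A) :
    ℕ → PMF (List (X × A))
  | 0 => PMF.pure []
  | k + 1 =>
      (dataLaw Φ H explore k).bind fun w =>
        (Φ.nextContext H w).bind fun x => (explore w x).map fun a => (x, a) :: w

end BMDP

/-- A reward-free learning algorithm for episodes of length `H`. While exploring, it draws each
action from a distribution that may depend on all past observations, of earlier episodes and of the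
current one, and on the current context. From the data and an internal randomization `ω : Ω`, whose
law may depend on the data, it then outputs a policy for each reward function. -/
structure Learner (A X Ω : Type*) [MeasurableSpace Ω] (H : ℕ) where
  explore : List (X × A) → X → PMF A
  seed : List (X × A) → MeasureTheory.ProbabilityMeasure Ω
  output : List (X × A) → Ω → Reward A X H → Policy A X H

/-- After `T` episodes in the BMDP `Φ`, with probability at least `1/2` over the data and the
internal randomization, the output of the learner satisfies
`sup_r (1/H) (V^⋆(r) - V^{π̂_r}(r)) ≤ ε`. The event is only asked to contain a measurable one of
probability at least `1/2`, so that no measurability of `output` is needed. -/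
def Learner.Guarantees {S A X Ω : Type*} [Fintype A] [Fintype X] [MeasurableSpace Ω] {H : ℕ}
    (L : Learner A X Ω H) (Φ : BMDP S A X) (T : ℕ) (ε : ℝ) : Prop :=
  ∃ E : List (X × A) → Set Ω,
    (∀ w, MeasurableSet (E w)) ∧
    (∀ w, ∀ ω ∈ E w, Φ.UniformlyNearOptimal (L.output w ω) ε) ∧
    (1 / 2 : ℝ≥0∞) ≤
      ∑' w, Φ.dataLaw H L.explore (T * H) w * (L.seed w : MeasureTheory.Measure Ω) (E w)

end

/-! The bound is an information argument over a cube of alternatives. In each cluster, `m` disjoint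
pairs of contexts are chosen, with `m` of order `n / (ηS)`. For a sign vector `σ`, the emission mass
is shifted by `± θ/n` inside the pairs, where `θ = κ ε`; the latent dynamics and the decoding
function do not change.

Two weakly correlated sign vectors `σ`, `σ'` cannot be served by the same output. A single context
reward, adapted to the two, has emission means `1/2 + ζ g` under `σ` and `1/2 + ζ g'` under `σ'`,
with `g`, `g'` free and `ζ` of order `θ m / n` (`exists_perturbed_family`). Taking `g` from a test
function `v` of `Λ` and `g'` from `-v` makes one model reward high `v` and the other low `v`.
Whatever action is played, the two gaps add up to the spread of the mean of `v` over actions, whose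
average over latent states is of order `Λ`, at each of the first `H - 1` stages
(`value_eq_sub_gaps`, `not_nearOptimal_both`). For `κ` large this exceeds `ε`.

Hence any given output succeeds only for sign vectors strongly correlated with one another, a
fraction at most `2 exp(-m/8)` of the cube (`card_correlated_le`). On the other hand, one
observation has chi-square cost at most `1 + η θ²` relative to an unshifted reference model, so
success with probability `1/2` under `σ` forces probability at least `1 / (4 (1 + η θ²)^(TH))` under
the reference (`one_le_of_half_le_dataLaw`). Summing over `σ` gives `exp(m/8) ≤ 8 (1 + η θ²)^(TH)`
(`Learner.exp_le_of_guarantees`), so `TH` is at least of order `m / θ²`, that is `n / ε²`; finally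
`Λ ≤ 2`. -/

/-! ### Chi-square change of measure for adaptively collected data -/

theorem tsum_bind_mul {α β : Type*} (p : PMF α) (g : α → PMF β) (F : β → ℝ≥0∞) :
    ∑' b, p.bind g b * F b = ∑' a, p a * ∑' b, g a b * F b := by
  simp_rw [PMF.bind_apply, ← ENNReal.tsum_mul_right, ← ENNReal.tsum_mul_left, mul_assoc]
  exact ENNReal.tsum_comm

theorem tsum_map_mul {α β : Type*} (p : PMF α) (g : α → β) (F : β → ℝ≥0∞) :
    ∑' b, p.map g b * F b = ∑' a, p a * F (g a) := by
  rw [PMF.map, tsum_bind_mul]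
  refine tsum_congr fun a => ?_
  rw [tsum_eq_single (g a)]
  · simp
  · intro b hb
    simp [hb]

/-- Expand `(l - 2 M g)² ≥ 0` and use `g² ≤ g`. This replaces Cauchy–Schwarz in the change of
measure and avoids square roots in `ℝ≥0∞`. -/
theorem ennreal_four_mul_le (M l g : ℝ≥0∞) (hM : M ≠ ∞) (hg : g ≤ 1) :
    4 * M * (l * g) ≤ l ^ 2 + 4 * M ^ 2 * g := by
  by_cases hl : l = ∞
  · simp [hl]
  have hg' : g ≠ ∞ := ne_top_of_le_ne_top ENNReal.one_ne_top hg
  lift l to NNReal using hl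
  lift g to NNReal using hg'
  lift M to NNReal using hM
  norm_cast at hg ⊢
  rw [← NNReal.coe_le_coe]
  push_cast
  have h1 : (g : ℝ) ≤ 1 := by exact_mod_cast hg
  nlinarith [sq_nonneg ((l : ℝ) - 2 * M * g), mul_nonneg (mul_nonneg (sq_nonneg (M : ℝ)) g.coe_nonneg)
    (sub_nonneg.2 h1)]

namespace BMDP

variable {S A X : Type*}

theorem tsum_dataLaw_succ (Φ : BMDP S A X) (H : ℕ) (explore : List (X × A) → X → PMF A) (k : ℕ)
    (F : List (X × A) → ℝ≥0∞) :
    ∑' w, Φ.dataLaw H explore (k + 1) w * F w =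
      ∑' w, Φ.dataLaw H explore k w *
        ∑' x, Φ.nextContext H w x * ∑' a, explore w x a * F ((x, a) :: w) := by
  rw [dataLaw, tsum_bind_mul]
  refine tsum_congr fun w => ?_
  rw [tsum_bind_mul]
  simp_rw [tsum_map_mul]

/-- The likelihood ratio of a trajectory under `Ψ` and `Φ`. -/
noncomputable def likelihoodRatio (Ψ Φ : BMDP S A X) (H : ℕ) : List (X × A) → ℝ≥0∞
  | [] => 1
  | z :: w => likelihoodRatio Ψ Φ H w * (Ψ.nextContext H w z.1 / Φ.nextContext H w z.1)

/-- Both models are explored by the same rule, so the action probabilities cancel and only context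
laws enter the ratio. -/
theorem tsum_dataLaw_eq_likelihoodRatio (Ψ Φ : BMDP S A X) (H : ℕ)
    (explore : List (X × A) → X → PMF A)
    (hac : ∀ w x, Φ.nextContext H w x = 0 → Ψ.nextContext H w x = 0) (k : ℕ)
    (F : List (X × A) → ℝ≥0∞) :
    ∑' w, Ψ.dataLaw H explore k w * F w =
      ∑' w, Φ.dataLaw H explore k w * (Ψ.likelihoodRatio Φ H w * F w) := by
  induction k generalizing F with
  | zero =>
    refine tsum_congr fun w => ?_
    rw [dataLaw, dataLaw, PMF.pure_apply]
    split_ifs with h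
    · subst h
      simp [likelihoodRatio]
    · simp
  | succ k ih =>
    rw [tsum_dataLaw_succ, tsum_dataLaw_succ, ih]
    refine tsum_congr fun w => ?_
    congr 1
    rw [← ENNReal.tsum_mul_left]
    refine tsum_congr fun x => ?_
    simp only [likelihoodRatio]
    have h : Φ.nextContext H w x * (Ψ.nextContext H w x / Φ.nextContext H w x) =
        Ψ.nextContext H w x :=
      ENNReal.mul_div_cancel' (hac w x) fun h => absurd h (PMF.apply_ne_top _ _)
    conv_lhs => rw [← h]
    simp_rw [← ENNReal.tsum_mul_left]
    refine tsum_congr fun a => ?_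
    ring

theorem tsum_dataLaw_likelihoodRatio_sq_le (Ψ Φ : BMDP S A X) (H : ℕ)
    (explore : List (X × A) → X → PMF A) (C : ℝ≥0∞)
    (hC : ∀ w, ∑' x, Φ.nextContext H w x *
      (Ψ.nextContext H w x / Φ.nextContext H w x) ^ 2 ≤ C) (k : ℕ) :
    ∑' w, Φ.dataLaw H explore k w * Ψ.likelihoodRatio Φ H w ^ 2 ≤ C ^ k := by
  induction k with
  | zero =>
    rw [tsum_eq_single []]
    · simp [dataLaw, likelihoodRatio]
    · intro w hw
      simp [dataLaw, hw]
  | succ k ih =>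
    rw [tsum_dataLaw_succ, pow_succ]
    calc ∑' w, Φ.dataLaw H explore k w * ∑' x, Φ.nextContext H w x *
          ∑' a, explore w x a * Ψ.likelihoodRatio Φ H ((x, a) :: w) ^ 2
        = ∑' w, (Φ.dataLaw H explore k w * Ψ.likelihoodRatio Φ H w ^ 2) *
          ∑' x, Φ.nextContext H w x * (Ψ.nextContext H w x / Φ.nextContext H w x) ^ 2 := by
          refine tsum_congr fun w => ?_
          rw [mul_assoc]
          congr 1
          rw [← ENNReal.tsum_mul_left]
          refine tsum_congr fun x => ?_
          simp only [likelihoodRatio]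
          rw [ENNReal.tsum_mul_right, PMF.tsum_coe]
          ring
      _ ≤ ∑' w, (Φ.dataLaw H explore k w * Ψ.likelihoodRatio Φ H w ^ 2) * C :=
          ENNReal.tsum_le_tsum fun w => by gcongr; exact hC w
      _ ≤ C ^ k * C := by
          rw [ENNReal.tsum_mul_right]
          gcongr

/-- Chi-square change of measure: an event of probability at least `1/2` under `Ψ` has probability
at least `1 / (4 C ^ k)` under `Φ`. -/
theorem one_le_of_half_le_dataLaw (Ψ Φ : BMDP S A X) (H : ℕ)
    (explore : List (X × A) → X → PMF A)
    (hac : ∀ w x, Φ.nextContext H w x = 0 → Ψ.nextContext H w x = 0) (C : ℝ≥0∞)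
    (hC1 : 1 ≤ C) (hCtop : C ≠ ∞)
    (hC : ∀ w, ∑' x, Φ.nextContext H w x *
      (Ψ.nextContext H w x / Φ.nextContext H w x) ^ 2 ≤ C) (k : ℕ)
    (g : List (X × A) → ℝ≥0∞) (hg : ∀ w, g w ≤ 1)
    (h : 1 / 2 ≤ ∑' w, Ψ.dataLaw H explore k w * g w) :
    1 ≤ 4 * C ^ k * ∑' w, Φ.dataLaw H explore k w * g w := by
  set M := C ^ k with hMdef
  set G := ∑' w, Φ.dataLaw H explore k w * g w with hG
  have hMtop : M ≠ ∞ := ENNReal.pow_ne_top hCtop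
  have hM0 : M ≠ 0 := (lt_of_lt_of_le one_pos (one_le_pow₀ hC1)).ne'
  -- The weight `4 M` is tuned so that the probability `1/2` contributes `2 M` on the left, one `M`
  -- more than the second moment of the likelihood ratio takes back.
  have key : 4 * M * ∑' w, Ψ.dataLaw H explore k w * g w ≤ M + 4 * M ^ 2 * G := by
    rw [tsum_dataLaw_eq_likelihoodRatio Ψ Φ H explore hac, ← ENNReal.tsum_mul_left]
    calc ∑' w, 4 * M * (Φ.dataLaw H explore k w * (Ψ.likelihoodRatio Φ H w * g w))
        ≤ ∑' w, (Φ.dataLaw H explore k w * Ψ.likelihoodRatio Φ H w ^ 2 +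
            4 * M ^ 2 * (Φ.dataLaw H explore k w * g w)) := by
          refine ENNReal.tsum_le_tsum fun w => ?_
          calc _ = Φ.dataLaw H explore k w * (4 * M * (Ψ.likelihoodRatio Φ H w * g w)) := by ring
            _ ≤ Φ.dataLaw H explore k w *
                (Ψ.likelihoodRatio Φ H w ^ 2 + 4 * M ^ 2 * g w) := by
              gcongr
              exact ennreal_four_mul_le _ _ _ hMtop (hg w)
            _ = _ := by ring
      _ = ∑' w, Φ.dataLaw H explore k w * Ψ.likelihoodRatio Φ H w ^ 2 + 4 * M ^ 2 * G := by
          rw [ENNReal.tsum_add, ENNReal.tsum_mul_left]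
      _ ≤ M + 4 * M ^ 2 * G := by
          gcongr
          exact tsum_dataLaw_likelihoodRatio_sq_le Ψ Φ H explore C hC k
  have h2 : M + M ≤ M + 4 * M ^ 2 * G := by
    refine le_trans ?_ key
    calc M + M = 4 * M * (1 / 2) := by
          have : (4 : ℝ≥0∞) * (1 / 2) = 2 := by
            rw [show (4 : ℝ≥0∞) = 2 * 2 by norm_num, mul_assoc, one_div,
              ENNReal.mul_inv_cancel (by norm_num) (by norm_num), mul_one]
          rw [mul_right_comm, this, two_mul]
      _ ≤ _ := by gcongr
  have h3 : M ≤ 4 * M ^ 2 * G := (ENNReal.add_le_add_iff_left hMtop).1 h2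
  have h4 : M * 1 ≤ M * (4 * M * G) := by
    rw [mul_one]
    calc M ≤ 4 * M ^ 2 * G := h3
      _ = _ := by ring
  exact (ENNReal.mul_le_mul_iff_right hM0 hMtop).1 h4

end BMDP

/-! ### Values of policies and accumulated gaps -/

theorem sum_toReal_bind_mul {α β : Type*} [Fintype α] [Fintype β] (p : PMF α) (g : α → PMF β)
    (F : β → ℝ) :
    ∑ b, (p.bind g b).toReal * F b = ∑ a, (p a).toReal * ∑ b, (g a b).toReal * F b := by
  have h : ∀ b, (p.bind g b).toReal = ∑ a, (p a).toReal * (g a b).toReal := fun b => by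
    rw [PMF.bind_apply, tsum_fintype, ENNReal.toReal_sum fun a _ =>
      ENNReal.mul_ne_top (PMF.apply_ne_top _ _) (PMF.apply_ne_top _ _)]
    simp_rw [ENNReal.toReal_mul]
  simp_rw [h, Finset.sum_mul, Finset.mul_sum, mul_assoc]
  exact Finset.sum_comm

theorem sum_toReal_map_mul {α β : Type*} [Fintype α] [Fintype β] (p : PMF α) (g : α → β)
    (F : β → ℝ) :
    ∑ b, (p.map g b).toReal * F b = ∑ a, (p a).toReal * F (g a) := by
  rw [PMF.map, sum_toReal_bind_mul]
  refine Finset.sum_congr rfl fun a _ => ?_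
  rw [Finset.sum_eq_single (g a)]
  · simp
  · intro b _ hb
    simp [hb]
  · simp

theorem sum_toReal_eq_one {α : Type*} [Fintype α] (p : PMF α) : ∑ a, (p a).toReal = 1 := by
  have h := p.tsum_coe
  rw [tsum_fintype] at h
  rw [← ENNReal.toReal_sum fun a _ => PMF.apply_ne_top _ _, h, ENNReal.toReal_one]

theorem sum_toReal_mul_le {α : Type*} [Fintype α] (p : PMF α) (F : α → ℝ) (c : ℝ)
    (h : ∀ a, F a ≤ c) : ∑ a, (p a).toReal * F a ≤ c := by
  calc ∑ a, (p a).toReal * F a ≤ ∑ a, (p a).toReal * c :=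
        Finset.sum_le_sum fun a _ => mul_le_mul_of_nonneg_left (h a) ENNReal.toReal_nonneg
    _ = c := by rw [← Finset.sum_mul, sum_toReal_eq_one, one_mul]

theorem abs_sum_toReal_mul_le {α : Type*} [Fintype α] (p : PMF α) (F : α → ℝ) (c : ℝ)
    (h : ∀ a, |F a| ≤ c) : |∑ a, (p a).toReal * F a| ≤ c := by
  refine abs_le.2 ⟨?_, sum_toReal_mul_le p F c fun a => (abs_le.1 (h a)).2⟩
  have := sum_toReal_mul_le p (fun a => -F a) c fun a => by linarith [(abs_le.1 (h a)).1]
  simp only [mul_neg, Finset.sum_neg_distrib] at this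
  linarith

namespace BMDP

variable {S A X : Type*}

/-- The mean of `W` at the next latent state. -/
noncomputable def latentMean [Fintype S] (Φ : BMDP S A X) (W : S → ℝ) (s : S) (a : A) : ℝ :=
  ∑ s', (Φ.p s a s').toReal * W s'

theorem sum_step_mul [Fintype S] [Fintype X] (Φ : BMDP S A X) (x : X) (a : A) (F : X → ℝ) :
    ∑ y, (Φ.step x a y).toReal * F y =
      Φ.latentMean (fun s => ∑ y, (Φ.q s y).toReal * F y) (Φ.f x) a := by
  rw [step, sum_toReal_bind_mul, latentMean]

theorem emission_eq_zero (Φ : BMDP S A X) {s : S} {y : X} (h : Φ.f y ≠ s) : Φ.q s y = 0 := by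
  rw [PMF.apply_eq_zero_iff, Φ.support_q]
  simpa using h

theorem emission_pos (Φ : BMDP S A X) (y : X) : 0 < (Φ.q (Φ.f y) y).toReal := by
  refine ENNReal.toReal_pos ?_ (PMF.apply_ne_top _ _)
  rw [Ne, PMF.apply_eq_zero_iff, Φ.support_q]
  simp

theorem sum_emission_comp [Fintype X] (Φ : BMDP S A X) (M : S → ℝ) (s : S) :
    ∑ y, (Φ.q s y).toReal * M (Φ.f y) = M s := by
  have : ∀ y, (Φ.q s y).toReal * M (Φ.f y) = (Φ.q s y).toReal * M s := fun y => by
    by_cases h : Φ.f y = s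
    · rw [h]
    · simp [Φ.emission_eq_zero h]
  simp_rw [this, ← Finset.sum_mul, sum_toReal_eq_one, one_mul]

section Stage

variable [Fintype A] [Fintype X] (Φ : BMDP S A X) {H : ℕ} (π : Policy A X H)

theorem sum_stageLaw_zero_mul (hh : 0 < H) (F : X × A → ℝ) :
    ∑ z, (Φ.stageLaw π 0 hh z).toReal * F z =
      ∑ x, (Φ.μ x).toReal * ∑ a, (π ⟨0, hh⟩ x a).toReal * F (x, a) := by
  rw [stageLaw, sum_toReal_bind_mul]
  simp_rw [sum_toReal_map_mul]

theorem sum_stageLaw_succ_mul (h : ℕ) (hh : h + 1 < H) (F : X × A → ℝ) :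
    ∑ z, (Φ.stageLaw π (h + 1) hh z).toReal * F z =
      ∑ z, (Φ.stageLaw π h (Nat.lt_of_succ_lt hh) z).toReal *
        ∑ y, (Φ.step z.1 z.2 y).toReal * ∑ a, (π ⟨h + 1, hh⟩ y a).toReal * F (y, a) := by
  rw [stageLaw, sum_toReal_bind_mul]
  refine Finset.sum_congr rfl fun z _ => ?_
  rw [sum_toReal_bind_mul]
  simp_rw [sum_toReal_map_mul]

theorem sum_stageLaw_zero_context (hh : 0 < H) (F : X → ℝ) :
    ∑ z, (Φ.stageLaw π 0 hh z).toReal * F z.1 = ∑ x, (Φ.μ x).toReal * F x := by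
  rw [sum_stageLaw_zero_mul]
  simp_rw [← Finset.sum_mul, sum_toReal_eq_one, one_mul]

theorem sum_stageLaw_succ_context [Fintype S] (h : ℕ) (hh : h + 1 < H) (F : X → ℝ) :
    ∑ z, (Φ.stageLaw π (h + 1) hh z).toReal * F z.1 =
      ∑ z, (Φ.stageLaw π h (Nat.lt_of_succ_lt hh) z).toReal *
        Φ.latentMean (fun s => ∑ y, (Φ.q s y).toReal * F y) (Φ.f z.1) z.2 := by
  rw [sum_stageLaw_succ_mul]
  simp_rw [← Finset.sum_mul, sum_toReal_eq_one, one_mul, sum_step_mul]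

/-- With context rewards whose emission means are `1/2 + ζ (W - M)`, and `1/2 + ζ W` at the last
stage, the value of a policy is a constant minus the accumulated gaps `M - latentMean W`. -/
theorem value_eq_sub_gaps [Fintype S] (K : ℕ) (π : Policy A X (K + 2)) (r : Reward A X (K + 2))
    (ρ : Fin (K + 2) → X → ℝ) (hr : ∀ h x a, (r h x a : ℝ) = ρ h x) (hρ0 : ∀ x, ρ 0 x = 0)
    (ζ : ℝ) (W M : S → ℝ)
    (hρ : ∀ i : Fin (K + 1), ∀ s, ∑ y, (Φ.q s y).toReal * ρ i.succ y =
      1 / 2 + ζ * (W s - if (i : ℕ) < K then M s else 0)) :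
    Φ.value r π = (K + 1 : ℝ) / 2 + ζ * ∑ x, (Φ.μ x).toReal * M (Φ.f x) -
      ζ * ∑ i : Fin (K + 1), ∑ z, (Φ.stageLaw π i (by omega) z).toReal *
        (M (Φ.f z.1) - Φ.latentMean W (Φ.f z.1) z.2) := by
  set m : Fin (K + 1) → ℝ := fun i =>
    ∑ z, (Φ.stageLaw π i (by omega) z).toReal * M (Φ.f z.1) with hm
  have hstage : ∀ i : Fin (K + 1),
      ∑ z, (Φ.stageLaw π i.succ i.succ.2 z).toReal * (r i.succ z.1 z.2 : ℝ) =
        1 / 2 + ζ * (∑ z, (Φ.stageLaw π i (by omega) z).toReal *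
          Φ.latentMean W (Φ.f z.1) z.2 -
          if h : (i : ℕ) < K then m ⟨i + 1, by omega⟩ else 0) := by
    intro i
    simp_rw [hr]
    have h1 := Φ.sum_stageLaw_succ_context π i i.succ.2 (ρ i.succ)
    simp only [Fin.val_succ] at h1 ⊢
    rw [h1]
    simp_rw [hρ]
    -- Emission averages of `M ∘ f` give back `M`, so the correction in the reward of stage `i + 1`
    -- is the mean of `M` at that stage. The last stage carries no correction, since no later reward
    -- depends on its action.
    have hM : (if h : (i : ℕ) < K then m ⟨i + 1, by omega⟩ else 0) =
        ∑ z, (Φ.stageLaw π i (by omega) z).toReal *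
          Φ.latentMean (fun s => if (i : ℕ) < K then M s else 0) (Φ.f z.1) z.2 := by
      split_ifs with h
      · have := Φ.sum_stageLaw_succ_context π i (by omega) (fun x => M (Φ.f x))
        simp_rw [sum_emission_comp] at this
        exact this
      · simp [latentMean]
    rw [hM, ← Finset.sum_sub_distrib, Finset.mul_sum]
    have h2 : (1 / 2 : ℝ) = ∑ z, (Φ.stageLaw π i (by omega) z).toReal * (1 / 2) := by
      rw [← Finset.sum_mul, sum_toReal_eq_one, one_mul]
    conv_rhs => rw [h2]
    rw [← Finset.sum_add_distrib]
    refine Finset.sum_congr rfl fun z _ => ?_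
    have h3 : (1 / 2 : ℝ) = ∑ s', (Φ.p (Φ.f z.1) z.2 s').toReal * (1 / 2) := by
      rw [← Finset.sum_mul, sum_toReal_eq_one, one_mul]
    have h4 : Φ.latentMean (fun s => 1 / 2 + ζ * (W s - if (i : ℕ) < K then M s else 0))
        (Φ.f z.1) z.2 = 1 / 2 + ζ * (Φ.latentMean W (Φ.f z.1) z.2 -
          Φ.latentMean (fun s => if (i : ℕ) < K then M s else 0) (Φ.f z.1) z.2) := by
      conv_rhs => rw [h3]
      simp only [latentMean]
      rw [← Finset.sum_sub_distrib, Finset.mul_sum, ← Finset.sum_add_distrib]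
      exact Finset.sum_congr rfl fun s' _ => by ring
    rw [h4]
    ring
  -- The corrections are the terms `m` shifted by one stage; only `m 0` is left over, and it does
  -- not depend on the policy.
  have htel : ∑ i : Fin (K + 1), (if h : (i : ℕ) < K then m ⟨i + 1, by omega⟩ else 0) =
      ∑ i, m i - m 0 := by
    rw [Fin.sum_univ_castSucc, Fin.sum_univ_succ (f := m)]
    simp
    rfl
  have hm0 : m 0 = ∑ x, (Φ.μ x).toReal * M (Φ.f x) :=
    Φ.sum_stageLaw_zero_context π (by omega) fun x => M (Φ.f x)
  rw [value, Fin.sum_univ_succ]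
  -- No reward is given at stage `0`: the initial context follows `μ`, not an emission law, so its
  -- mean reward is not controlled.
  have h0 : ∑ z, (Φ.stageLaw π (0 : Fin (K + 2)) (0 : Fin (K + 2)).2 z).toReal *
      (r 0 z.1 z.2 : ℝ) = 0 := by
    simp [hr, hρ0]
  rw [h0, zero_add, Finset.sum_congr rfl fun i _ => hstage i]
  simp_rw [mul_sub, Finset.sum_add_distrib, Finset.sum_sub_distrib]
  rw [← Finset.mul_sum, ← Finset.mul_sum, htel, ← hm0]
  simp only [Finset.sum_const, Finset.card_univ, Fintype.card_fin, hm, nsmul_eq_mul]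
  push_cast
  ring

theorem value_le (r : Reward A X H) : Φ.value r π ≤ H := by
  calc Φ.value r π ≤ ∑ _h : Fin H, (1 : ℝ) :=
        Finset.sum_le_sum fun h _ => sum_toReal_mul_le _ _ 1 fun z => (r h z.1 z.2).2.2
    _ = H := by simp

theorem value_le_optValue (r : Reward A X H) : Φ.value r π ≤ Φ.optValue r :=
  le_ciSup (f := fun π : Policy A X H => Φ.value r π)
    ⟨H, by rintro _ ⟨π, rfl⟩; exact Φ.value_le π r⟩ π

/-- Whatever was played before, each context has probability at least `κ` at each stage. A policy
therefore pays for its mistakes at all contexts and cannot steer away from them. -/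
theorem le_sum_stageLaw (κ : ℝ) (hμ : ∀ x, κ ≤ (Φ.μ x).toReal)
    (hstep : ∀ x a y, κ ≤ (Φ.step x a y).toReal) (F : X × A → ℝ) (hF : ∀ z, 0 ≤ F z) (h : ℕ)
    (hh : h < H) :
    κ * ∑ x, ∑ a, (π ⟨h, hh⟩ x a).toReal * F (x, a) ≤
      ∑ z, (Φ.stageLaw π h hh z).toReal * F z := by
  have hpos : ∀ x, 0 ≤ ∑ a, (π ⟨h, hh⟩ x a).toReal * F (x, a) := fun x =>
    Finset.sum_nonneg fun a _ => mul_nonneg ENNReal.toReal_nonneg (hF _)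
  cases h with
  | zero =>
    rw [sum_stageLaw_zero_mul, Finset.mul_sum]
    exact Finset.sum_le_sum fun x _ => mul_le_mul_of_nonneg_right (hμ x) (hpos x)
  | succ h =>
    rw [sum_stageLaw_succ_mul]
    calc κ * ∑ x, ∑ a, (π ⟨h + 1, hh⟩ x a).toReal * F (x, a)
        = ∑ z, (Φ.stageLaw π h (Nat.lt_of_succ_lt hh) z).toReal *
            (κ * ∑ x, ∑ a, (π ⟨h + 1, hh⟩ x a).toReal * F (x, a)) := by
          rw [← Finset.sum_mul, sum_toReal_eq_one, one_mul]
      _ ≤ _ := by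
          refine Finset.sum_le_sum fun z _ =>
            mul_le_mul_of_nonneg_left ?_ ENNReal.toReal_nonneg
          rw [Finset.mul_sum]
          exact Finset.sum_le_sum fun y _ =>
            mul_le_mul_of_nonneg_right (hstep _ _ _) (hpos y)

end Stage

/-- In the setting of `value_eq_sub_gaps`, the suboptimality of a policy dominates its accumulated
gaps over the contexts. -/
theorem gaps_le_suboptimality [Fintype S] [Fintype A] [Fintype X] (Φ : BMDP S A X) (K : ℕ)
    (π : Policy A X (K + 2)) (r : Reward A X (K + 2))
    (ρ : Fin (K + 2) → X → ℝ) (hr : ∀ h x a, (r h x a : ℝ) = ρ h x) (hρ0 : ∀ x, ρ 0 x = 0)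
    (ζ : ℝ) (hζ : 0 ≤ ζ) (W M : S → ℝ)
    (hρ : ∀ i : Fin (K + 1), ∀ s, ∑ y, (Φ.q s y).toReal * ρ i.succ y =
      1 / 2 + ζ * (W s - if (i : ℕ) < K then M s else 0))
    (hM : ∀ s a, Φ.latentMean W s a ≤ M s) (hM' : ∀ s, ∃ a, Φ.latentMean W s a = M s)
    (κ : ℝ) (hμ : ∀ x, κ ≤ (Φ.μ x).toReal) (hstep : ∀ x a y, κ ≤ (Φ.step x a y).toReal) :
    ζ * (κ * ∑ i : Fin (K + 1), ∑ x, ∑ a, (π i.castSucc x a).toReal *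
      (M (Φ.f x) - Φ.latentMean W (Φ.f x) a)) ≤ Φ.optValue r - Φ.value r π := by
  -- The comparison policy plays a maximizing action in each latent state, so all its gaps vanish.
  choose g hg using hM'
  have hopt := Φ.value_le_optValue (fun _ x => PMF.pure (g (Φ.f x))) r
  have hgreedy : ∑ i : Fin (K + 1), ∑ z, (Φ.stageLaw (H := K + 2)
      (fun _ x => PMF.pure (g (Φ.f x))) i (by omega) z).toReal *
        (M (Φ.f z.1) - Φ.latentMean W (Φ.f z.1) z.2) = 0 := by
    refine Finset.sum_eq_zero fun i _ => ?_
    have hz : ∀ x, ∑ a, ((PMF.pure (g (Φ.f x)) : PMF A) a).toReal *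
        (M (Φ.f x) - Φ.latentMean W (Φ.f x) a) = 0 := fun x => by
      refine Finset.sum_eq_zero fun a _ => ?_
      by_cases h : a = g (Φ.f x)
      · subst h; simp [hg]
      · simp [h]
    obtain ⟨i, hi⟩ := i
    cases i with
    | zero => simp only [sum_stageLaw_zero_mul, hz, mul_zero, Finset.sum_const_zero]
    | succ i => simp only [sum_stageLaw_succ_mul, hz, mul_zero, Finset.sum_const_zero]
  have h1 := Φ.value_eq_sub_gaps K π r ρ hr hρ0 ζ W M hρ
  have h2 := Φ.value_eq_sub_gaps K (fun _ x => PMF.pure (g (Φ.f x))) r ρ hr hρ0 ζ W M hρ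
  rw [hgreedy] at h2
  have h3 : κ * ∑ i : Fin (K + 1), ∑ x, ∑ a, (π i.castSucc x a).toReal *
      (M (Φ.f x) - Φ.latentMean W (Φ.f x) a) ≤
      ∑ i : Fin (K + 1), ∑ z, (Φ.stageLaw π i (by omega) z).toReal *
        (M (Φ.f z.1) - Φ.latentMean W (Φ.f z.1) z.2) := by
    rw [Finset.mul_sum]
    exact Finset.sum_le_sum fun i _ => Φ.le_sum_stageLaw π κ hμ hstep
      (fun z => M (Φ.f z.1) - Φ.latentMean W (Φ.f z.1) z.2) (fun z => sub_nonneg.2 (hM _ _)) i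
      (by omega)
  have h4 := mul_le_mul_of_nonneg_left h3 hζ
  linarith

end BMDP

/-! ### Consequences of regularity and the cost of one observation -/

theorem exists_pmf_toReal_eq {X : Type*} [Fintype X] (Q : X → ℝ) (h0 : ∀ x, 0 ≤ Q x)
    (h1 : ∑ x, Q x = 1) : ∃ p : PMF X, ∀ x, (p x).toReal = Q x := by
  refine ⟨PMF.ofFintype (fun x => ENNReal.ofReal (Q x)) ?_, fun x => ?_⟩
  · rw [← ENNReal.ofReal_sum_of_nonneg fun x _ => h0 x, h1, ENNReal.ofReal_one]
  · rw [PMF.ofFintype_apply, ENNReal.toReal_ofReal (h0 x)]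

namespace BMDP

variable {S A X : Type*}

theorem exists_of_emission [Fintype X] (Φ : BMDP S A X) (Q : S → X → ℝ)
    (hpos : ∀ x, 0 < Q (Φ.f x) x) (hzero : ∀ s x, Φ.f x ≠ s → Q s x = 0)
    (hsum : ∀ s, ∑ x, Q s x = 1) :
    ∃ Ψ : BMDP S A X, Ψ.μ = Φ.μ ∧ Ψ.p = Φ.p ∧ Ψ.f = Φ.f ∧ ∀ s x, (Ψ.q s x).toReal = Q s x := by
  have h0 : ∀ s x, 0 ≤ Q s x := fun s x => by
    by_cases h : Φ.f x = s
    · subst h; exact (hpos x).le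
    · exact (hzero s x h).ge
  choose q hq using fun s => exists_pmf_toReal_eq (Q s) (h0 s) (hsum s)
  refine ⟨⟨Φ.μ, Φ.p, q, Φ.f, fun s => ?_⟩, rfl, rfl, rfl, hq⟩
  ext x
  rw [PMF.mem_support_iff, ← ENNReal.toReal_ne_zero.trans (and_iff_left (PMF.apply_ne_top _ _)), hq]
  simp only [Set.mem_preimage, Set.mem_singleton_iff]
  refine ⟨fun h => by_contra fun h' => h (hzero s x h'), fun h => ?_⟩
  subst h
  exact (hpos x).ne'

theorem step_toReal (Φ : BMDP S A X) (x : X) (a : A) (y : X) :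
    (Φ.step x a y).toReal = (Φ.p (Φ.f x) a (Φ.f y)).toReal * (Φ.q (Φ.f y) y).toReal := by
  rw [step, PMF.bind_apply, tsum_eq_single (Φ.f y), ENNReal.toReal_mul]
  intro s hs
  rw [Φ.emission_eq_zero hs.symm, mul_zero]

section Bounds

variable [Fintype S] {Φ : BMDP S A X} {α : S → ℝ} {η : ℝ}

theorem Regular.one_le_card_mul_p (hr : Φ.Regular α η) (s : S) (a : A) (t : S) :
    1 ≤ Fintype.card S * (η * (Φ.p s a t).toReal) := by
  rw [← sum_toReal_eq_one (Φ.p s a)]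
  calc ∑ u, (Φ.p s a u).toReal ≤ ∑ _u : S, η * (Φ.p s a t).toReal :=
        Finset.sum_le_sum fun u _ => (hr.2.1 a s u t).1
    _ = _ := by simp

variable [Fintype X]

theorem Regular.one_le_card_mul (hr : Φ.Regular α η) (hl : Φ.LinearClusters α) (s : S) :
    1 ≤ Fintype.card S * (η * α s) := by
  rw [← hl.2.1]
  calc ∑ t, α t ≤ ∑ _t : S, η * α s := Finset.sum_le_sum fun t _ => hr.1 t s
    _ = _ := by simp

open Classical in
theorem LinearClusters.sum_cluster_const (hl : Φ.LinearClusters α) (s : S) (c : ℝ) :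
    ∑ x, (if Φ.f x = s then c else 0) = α s * Fintype.card X * c := by
  rw [← hl.2.2 s, ← Finset.sum_filter, Finset.sum_const, nsmul_eq_mul]
  congr 2
  rw [Set.ncard_eq_toFinset_card']
  congr 1
  ext x
  simp

theorem LinearClusters.le_one (hl : Φ.LinearClusters α) (s : S) : α s ≤ 1 := by
  rw [← hl.2.1]
  exact Finset.single_le_sum (fun t _ => (hl.1 t).le) (Finset.mem_univ s)

theorem Regular.one_le_cluster_mul_emission (hr : Φ.Regular α η) (hl : Φ.LinearClusters α)
    (y : X) : 1 ≤ α (Φ.f y) * Fintype.card X * (η * (Φ.q (Φ.f y) y).toReal) := by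
  classical
  rw [← hl.sum_cluster_const, ← sum_toReal_eq_one (Φ.q (Φ.f y))]
  refine Finset.sum_le_sum fun x _ => ?_
  split_ifs with h
  · exact hr.2.2 _ x y h rfl
  · simp [Φ.emission_eq_zero h]

theorem Regular.cluster_mul_emission_le (hr : Φ.Regular α η) (hl : Φ.LinearClusters α)
    (y : X) : α (Φ.f y) * Fintype.card X * (Φ.q (Φ.f y) y).toReal ≤ η := by
  classical
  calc _ = ∑ x, (if Φ.f x = Φ.f y then (Φ.q (Φ.f y) y).toReal else 0) :=
        (hl.sum_cluster_const _ _).symm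
    _ ≤ ∑ x, η * (Φ.q (Φ.f y) x).toReal := by
        refine Finset.sum_le_sum fun x _ => ?_
        split_ifs with h
        · exact hr.2.2 _ y x rfl h
        · simp [Φ.emission_eq_zero h]
    _ = η := by rw [← Finset.mul_sum, sum_toReal_eq_one, mul_one]

theorem Regular.one_le_card_mul_emission (hη : 0 < η) (hr : Φ.Regular α η)
    (hl : Φ.LinearClusters α) (y : X) :
    1 ≤ Fintype.card X * (η * (Φ.q (Φ.f y) y).toReal) := by
  refine (hr.one_le_cluster_mul_emission hl y).trans ?_
  have : (0 : ℝ) ≤ Fintype.card X := by positivity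
  calc _ ≤ 1 * (Fintype.card X : ℝ) * (η * (Φ.q (Φ.f y) y).toReal) := by
        gcongr
        exact hl.le_one _
    _ = _ := by ring

theorem Regular.le_step (hη : 0 < η) (hr : Φ.Regular α η) (hl : Φ.LinearClusters α) (x : X)
    (a : A) (y : X) :
    1 / (η ^ 2 * Fintype.card S * Fintype.card X) ≤ (Φ.step x a y).toReal := by
  have h1 := hr.one_le_card_mul_p (Φ.f x) a (Φ.f y)
  have h2 := hr.one_le_card_mul_emission hη hl y
  have hS : (0 : ℝ) < Fintype.card S := by exact_mod_cast Fintype.card_pos_iff.2 ⟨Φ.f x⟩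
  have hX : (0 : ℝ) < Fintype.card X := by exact_mod_cast Fintype.card_pos_iff.2 ⟨x⟩
  rw [step_toReal, div_le_iff₀ (by positivity)]
  calc (1 : ℝ) = 1 * 1 := by ring
    _ ≤ _ := mul_le_mul h1 h2 zero_le_one (by linarith)
    _ = _ := by ring

/-- The chi-square divergence of one observation when the emissions are perturbed. -/
theorem Regular.tsum_nextContext_le (hη : 0 < η) (hr : Φ.Regular α η) (hl : Φ.LinearClusters α)
    (Ψ : BMDP S A X) (hμ : Ψ.μ = Φ.μ) (hp : Ψ.p = Φ.p) (hf : Ψ.f = Φ.f) (θ : ℝ)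
    (hq : ∀ s x, |(Ψ.q s x).toReal - (Φ.q s x).toReal| ≤ θ / Fintype.card X) (H : ℕ)
    (w : List (X × A)) :
    ∑' x, Φ.nextContext H w x * (Ψ.nextContext H w x / Φ.nextContext H w x) ^ 2 ≤
      ENNReal.ofReal (1 + η * θ ^ 2) := by
  have hinit : ∑' x, Φ.μ x * (Ψ.μ x / Φ.μ x) ^ 2 ≤ ENNReal.ofReal (1 + η * θ ^ 2) := by
    calc ∑' x, Φ.μ x * (Ψ.μ x / Φ.μ x) ^ 2 ≤ ∑' x, Φ.μ x := by
          refine ENNReal.tsum_le_tsum fun x => ?_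
          rw [hμ]
          calc _ ≤ Φ.μ x * 1 ^ 2 := by gcongr; exact ENNReal.div_self_le_one
            _ = _ := by simp
      _ = 1 := PMF.tsum_coe _
      _ ≤ _ := by
          rw [← ENNReal.ofReal_one]
          exact ENNReal.ofReal_le_ofReal (by nlinarith [mul_nonneg hη.le (sq_nonneg θ)])
  have hstep : ∀ x a, ∑' y, Φ.step x a y * (Ψ.step x a y / Φ.step x a y) ^ 2 ≤
      ENNReal.ofReal (1 + η * θ ^ 2) := by
    intro x a
    have hX : (0 : ℝ) < Fintype.card X := by exact_mod_cast Fintype.card_pos_iff.2 ⟨x⟩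
    -- With `b`, `c` the two emission masses and `p` the common transition probability, `(pc)²/(pb)
    -- = 2pc - pb + p (c - b)²/b`. The first two terms sum to `1` over `y`, and `b ≥ 1/(η n)`
    -- controls the third.
    have hterm : ∀ y, Φ.step x a y * (Ψ.step x a y / Φ.step x a y) ^ 2 ≠ ∞ ∧
        (Φ.step x a y * (Ψ.step x a y / Φ.step x a y) ^ 2).toReal ≤
          2 * (Ψ.step x a y).toReal - (Φ.step x a y).toReal + η * θ ^ 2 / Fintype.card X := by
      intro y
      have hb := Φ.emission_pos y
      have h2 := hr.one_le_card_mul_emission hη hl y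
      have hpp : 0 < (Φ.p (Φ.f x) a (Φ.f y)).toReal := by
        have h1 := hr.one_le_card_mul_p (Φ.f x) a (Φ.f y)
        by_contra h
        have h0 : (Φ.p (Φ.f x) a (Φ.f y)).toReal = 0 :=
          le_antisymm (not_lt.1 h) ENNReal.toReal_nonneg
        rw [h0] at h1
        norm_num at h1
      have hp1 : (Φ.p (Φ.f x) a (Φ.f y)).toReal ≤ 1 :=
        ENNReal.toReal_le_of_le_ofReal zero_le_one (by simpa using PMF.coe_le_one _ _)
      have hΦ0 : Φ.step x a y ≠ 0 := fun h => by
        have := Φ.step_toReal x a y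
        rw [h, ENNReal.toReal_zero] at this
        exact (mul_pos hpp hb).ne this
      have hne : Φ.step x a y * (Ψ.step x a y / Φ.step x a y) ^ 2 ≠ ∞ :=
        ENNReal.mul_ne_top (PMF.apply_ne_top _ _)
          (ENNReal.pow_ne_top (ENNReal.div_ne_top (PMF.apply_ne_top _ _) hΦ0))
      refine ⟨hne, ?_⟩
      rw [ENNReal.toReal_mul, ENNReal.toReal_pow, ENNReal.toReal_div, step_toReal, step_toReal, hp,
        hf]
      have hd := hq (Φ.f y) y
      set b := (Φ.q (Φ.f y) y).toReal
      set c := (Ψ.q (Φ.f y) y).toReal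
      set p := (Φ.p (Φ.f x) a (Φ.f y)).toReal
      have hsq : (c - b) ^ 2 ≤ (θ / Fintype.card X) ^ 2 := sq_le_sq' (by
        linarith [(abs_le.1 hd).1]) (abs_le.1 hd).2
      have h3 : (c - b) ^ 2 / b ≤ η * θ ^ 2 / Fintype.card X := by
        rw [div_le_iff₀ hb]
        calc (c - b) ^ 2 ≤ (θ / Fintype.card X) ^ 2 * 1 := by rw [mul_one]; exact hsq
          _ ≤ (θ / Fintype.card X) ^ 2 * (Fintype.card X * (η * b)) := by gcongr
          _ = _ := by field_simp
      have h4 : p * ((c - b) ^ 2 / b) ≤ 1 * (η * θ ^ 2 / Fintype.card X) :=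
        mul_le_mul hp1 h3 (by positivity) zero_le_one
      calc p * b * (p * c / (p * b)) ^ 2 = 2 * (p * c) - p * b + p * ((c - b) ^ 2 / b) := by
            field_simp
            ring
        _ ≤ _ := by linarith
    rw [tsum_fintype, ← ENNReal.ofReal_toReal (ENNReal.sum_ne_top.2 fun y _ => (hterm y).1),
      ENNReal.toReal_sum fun y _ => (hterm y).1]
    refine ENNReal.ofReal_le_ofReal ((Finset.sum_le_sum fun y _ => (hterm y).2).trans ?_)
    rw [Finset.sum_add_distrib, Finset.sum_sub_distrib, ← Finset.mul_sum, sum_toReal_eq_one,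
      sum_toReal_eq_one, Finset.sum_const, Finset.card_univ, nsmul_eq_mul,
      mul_div_cancel₀ _ hX.ne']
    linarith
  cases w with
  | nil => exact hinit
  | cons z w =>
    simp only [nextContext]
    split_ifs
    · exact hinit
    · exact hstep _ _

end Bounds

end BMDP

/-! ### Correlations of sign vectors -/

/-- The sign `1` of `true` and `-1` of `false`. -/
def boolSign (b : Bool) : ℝ := if b then 1 else -1

theorem boolSign_eq_or (b : Bool) : boolSign b = 1 ∨ boolSign b = -1 := by
  cases b <;> simp [boolSign]

theorem abs_boolSign (b : Bool) : |boolSign b| = 1 := by cases b <;> simp [boolSign]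

theorem boolSign_mul_self (b : Bool) : boolSign b * boolSign b = 1 := by
  cases b <;> simp [boolSign]

/-- Two weakly correlated sign vectors have independent prescribed correlations with a bounded
vector. -/
theorem exists_prescribed_correlations {m : ℕ} (hm : 0 < m) (σ σ' : Fin m → Bool)
    (h : |∑ j, boolSign (σ j) * boolSign (σ' j)| ≤ (m : ℝ) / 2) (a b : ℝ)
    (ha : |a| ≤ (m : ℝ) / 2) (hb : |b| ≤ (m : ℝ) / 2) :
    ∃ τ : Fin m → ℝ, (∀ j, |τ j| ≤ 2) ∧ ∑ j, boolSign (σ j) * τ j = a ∧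
      ∑ j, boolSign (σ' j) * τ j = b := by
  set R := ∑ j, boolSign (σ j) * boolSign (σ' j) with hR
  have hm' : (0 : ℝ) < m := by exact_mod_cast hm
  rw [abs_le] at h ha hb
  have h1 : 0 < m + R := by linarith
  have h2 : 0 < m - R := by linarith
  have hp : |(a + b) / (m + R)| ≤ 2 := by
    rw [abs_div, abs_of_pos h1, div_le_iff₀ h1, abs_le]
    constructor <;> linarith
  have hq : |(a - b) / (m - R)| ≤ 2 := by
    rw [abs_div, abs_of_pos h2, div_le_iff₀ h2, abs_le]
    constructor <;> linarith
  set p := (a + b) / (m + R) with hpdef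
  set q := (a - b) / (m - R) with hqdef
  have hp' : p * (m + R) = a + b := div_mul_cancel₀ _ h1.ne'
  have hq' : q * (m - R) = a - b := div_mul_cancel₀ _ h2.ne'
  -- This `τ` is `σ p` where the two signs agree and `σ q` where they differ. Those sets have sizes
  -- `(m + R)/2` and `(m - R)/2`, both at least `m/4`, which bounds `p` and `q` by `2`.
  refine ⟨fun j => (p + q) / 2 * boolSign (σ j) + (p - q) / 2 * boolSign (σ' j), fun j => ?_,
    ?_, ?_⟩
  · rw [abs_le] at hp hq ⊢
    rcases boolSign_eq_or (σ j) with h | h <;> rcases boolSign_eq_or (σ' j) with h' | h' <;>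
      simp only [h, h'] <;> constructor <;> linarith
  · have : ∀ j, boolSign (σ j) * ((p + q) / 2 * boolSign (σ j) + (p - q) / 2 * boolSign (σ' j)) =
        (p + q) / 2 + (p - q) / 2 * (boolSign (σ j) * boolSign (σ' j)) := fun j => by
      linear_combination (p + q) / 2 * boolSign_mul_self (σ j)
    simp_rw [this]
    rw [Finset.sum_add_distrib, ← Finset.mul_sum, ← hR]
    simp
    linarith
  · have : ∀ j, boolSign (σ' j) * ((p + q) / 2 * boolSign (σ j) + (p - q) / 2 * boolSign (σ' j)) =
        (p + q) / 2 * (boolSign (σ j) * boolSign (σ' j)) + (p - q) / 2 := fun j => by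
      linear_combination (p - q) / 2 * boolSign_mul_self (σ' j)
    simp_rw [this]
    rw [Finset.sum_add_distrib, ← Finset.mul_sum, ← hR]
    simp
    linarith

/-- Few sign vectors are strongly correlated with a given one. -/
theorem card_correlated_le {m : ℕ} (σ : Fin m → Bool) :
    ((Finset.univ.filter fun σ' : Fin m → Bool =>
      (m : ℝ) / 2 < |∑ j, boolSign (σ j) * boolSign (σ' j)|).card : ℝ) ≤
      2 * (2 ^ m * Real.exp (-(m / 8 : ℝ))) := by
  -- Chernoff bound with `t = ± 1/2`: the moment `exp(m/8)` against the threshold `exp(m/4)`.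
  have hexp : ∀ t : ℝ, |t| = 1 / 2 →
      ∑ σ' : Fin m → Bool, Real.exp (t * ∑ j, boolSign (σ j) * boolSign (σ' j)) ≤
        2 ^ m * Real.exp (m / 8) := by
    intro t ht
    have h1 : ∀ σ' : Fin m → Bool, Real.exp (t * ∑ j, boolSign (σ j) * boolSign (σ' j)) =
        ∏ j, Real.exp (t * (boolSign (σ j) * boolSign (σ' j))) := fun σ' => by
      rw [Finset.mul_sum, Real.exp_sum]
    have h2 : ∑ σ' : Fin m → Bool, ∏ j, Real.exp (t * (boolSign (σ j) * boolSign (σ' j))) =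
        ∏ j, ∑ b : Bool, Real.exp (t * (boolSign (σ j) * boolSign b)) := by
      rw [Finset.prod_univ_sum, Fintype.piFinset_univ]
    simp_rw [h1]
    rw [h2]
    have h3 : ∀ j, ∑ b : Bool, Real.exp (t * (boolSign (σ j) * boolSign b)) ≤
        2 * Real.exp (1 / 8) := fun j => by
      have h4 : ∑ b : Bool, Real.exp (t * (boolSign (σ j) * boolSign b)) = 2 * Real.cosh t := by
        rw [Real.cosh_eq, Fintype.sum_bool]
        cases σ j <;> simp [boolSign] <;> ring
      rw [h4]
      have h5 := Real.cosh_le_exp_half_sq t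
      have h6 : t ^ 2 / 2 = 1 / 8 := by rw [← sq_abs, ht]; norm_num
      rw [h6] at h5
      linarith
    calc ∏ j, ∑ b : Bool, Real.exp (t * (boolSign (σ j) * boolSign b))
        ≤ ∏ _j : Fin m, (2 * Real.exp (1 / 8)) :=
          Finset.prod_le_prod (fun j _ => Finset.sum_nonneg fun b _ => (Real.exp_pos _).le)
            fun j _ => h3 j
      _ = 2 ^ m * Real.exp (m / 8) := by
          rw [Finset.prod_const, Finset.card_univ, Fintype.card_fin, mul_pow, ← Real.exp_nat_mul]
          congr 2
          ring
  have h1 : ((Finset.univ.filter fun σ' : Fin m → Bool =>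
      (m : ℝ) / 2 < |∑ j, boolSign (σ j) * boolSign (σ' j)|).card : ℝ) * Real.exp (m / 4) ≤
      2 ^ m * Real.exp (m / 8) + 2 ^ m * Real.exp (m / 8) := by
    refine le_trans ?_ (add_le_add (hexp (1 / 2) (by norm_num)) (hexp (-(1 / 2)) (by norm_num)))
    rw [← Finset.sum_add_distrib, ← nsmul_eq_mul, ← Finset.sum_const]
    refine (Finset.sum_le_sum fun σ' hσ' => ?_).trans
      (Finset.sum_le_sum_of_subset_of_nonneg (Finset.filter_subset _ _) fun σ' _ _ => by positivity)
    have h := (Finset.mem_filter.1 hσ').2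
    set R := ∑ j, boolSign (σ j) * boolSign (σ' j)
    rcases lt_abs.1 h with h | h
    · have : Real.exp (m / 4) ≤ Real.exp (1 / 2 * R) := Real.exp_le_exp.2 (by linarith)
      linarith [Real.exp_pos (-(1 / 2) * R)]
    · have : Real.exp (m / 4) ≤ Real.exp (-(1 / 2) * R) := Real.exp_le_exp.2 (by linarith)
      linarith [Real.exp_pos (1 / 2 * R)]
  have h2 : Real.exp ((m : ℝ) / 8) = Real.exp (-(m / 8 : ℝ)) * Real.exp (m / 4) := by
    rw [← Real.exp_add]
    congr 1
    ring
  rw [h2] at h1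
  refine le_of_mul_le_mul_right ?_ (Real.exp_pos ((m : ℝ) / 4))
  linarith

/-! ### Perturbed emissions on pairs of contexts -/

section Pairs

variable {S X : Type*} {m : ℕ}

/-- The function on contexts with the value `± c (s, j) b` at the two points `e (s, j, b)`. -/
noncomputable def pairFun (e : S × Fin m × Bool → X) (c : S → Fin m → Bool → ℝ) : X → ℝ :=
  Function.extend e (fun t => boolSign t.2.2 * c t.1 t.2.1 t.2.2) 0

theorem pairFun_apply {e : S × Fin m × Bool → X} (he : e.Injective) (c : S → Fin m → Bool → ℝ)
    (s : S) (j : Fin m) (b : Bool) : pairFun e c (e (s, j, b)) = boolSign b * c s j b :=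
  he.extend_apply _ _ _

theorem pairFun_induction (e : S × Fin m × Bool → X) (c : S → Fin m → Bool → ℝ) (P : ℝ → Prop)
    (he : e.Injective) (h0 : P 0) (h : ∀ s j b, P (boolSign b * c s j b)) (x : X) :
    P (pairFun e c x) := by
  by_cases hx : ∃ t, e t = x
  · obtain ⟨⟨s, j, b⟩, rfl⟩ := hx
    rw [pairFun_apply he]
    exact h s j b
  · rw [pairFun, Function.extend_apply' _ _ _ hx]
    exact h0

open Classical in
theorem sum_pairFun_mul [Fintype S] [Fintype X] {e : S × Fin m × Bool → X} (he : e.Injective) (f : X → S)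
    (hf : ∀ t, f (e t) = t.1) (c : S → Fin m → Bool → ℝ) (F : X → ℝ) (s : S) :
    ∑ x, (if f x = s then pairFun e c x * F x else 0) =
      ∑ j, (c s j true * F (e (s, j, true)) - c s j false * F (e (s, j, false))) := by
  rw [← Fintype.sum_of_injective e he
    (fun t => if t.1 = s then boolSign t.2.2 * c t.1 t.2.1 t.2.2 * F (e t) else 0)]
  · rw [Fintype.sum_prod_type, Finset.sum_eq_single s]
    · rw [Fintype.sum_prod_type]
      refine Finset.sum_congr rfl fun j _ => ?_
      simp [boolSign]
      ring
    · intro t _ ht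
      simp [ht]
    · simp
  · intro x hx
    have : pairFun e c x = 0 := Function.extend_apply' _ _ _ hx
    simp [this]
  · rintro ⟨t, j, b⟩
    simp only [hf, pairFun_apply he]

end Pairs

namespace BMDP

variable {S A X : Type*} [Fintype X]

open Classical in
/-- The emission distributions, mixed with the uniform ones on the clusters and shifted by `ξ`. -/
noncomputable def perturbedEmission (Φ : BMDP S A X) (α : S → ℝ) (δ : ℝ) (ξ : X → ℝ) (s : S)
    (x : X) : ℝ :=
  if Φ.f x = s then
    (1 - δ) * (Φ.q s x).toReal + δ / (α s * Fintype.card X) + ξ x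
  else 0

open Classical in
theorem sum_perturbedEmission_mul (Φ : BMDP S A X) (α : S → ℝ) (δ : ℝ) (ξ F : X → ℝ) (s : S) :
    ∑ x, Φ.perturbedEmission α δ ξ s x * F x =
      ∑ x, Φ.perturbedEmission α δ 0 s x * F x +
        ∑ x, (if Φ.f x = s then ξ x * F x else 0) := by
  rw [← Finset.sum_add_distrib]
  refine Finset.sum_congr rfl fun x _ => ?_
  unfold perturbedEmission
  split_ifs
  · simp; ring
  · simp

variable [Fintype S]

-- The ratio of emissions may already equal `η`, so a bare shift could break regularity. Mixing with
-- the uniform laws gains `(η - 1) δ / (α_s n)` in the ratio inequality, while the shift loses at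
-- most `(1 + η) θ / n`. The condition `hδ` compares the two and also gives `θ < δ`, hence
-- positivity on the cluster.
open Classical in
theorem exists_perturbed (Φ : BMDP S A X) (α : S → ℝ) (η : ℝ) (hη : 1 < η)
    (hl : Φ.LinearClusters α) (hr : Φ.Regular α η) (hX : (0 : ℝ) < Fintype.card X)
    (δ θ : ℝ) (hθ : 0 < θ) (hδ1 : δ ≤ 1) (hδ : (1 + η) * θ ≤ (η - 1) * δ) (ξ : X → ℝ)
    (hξ : ∀ x, |ξ x| ≤ θ / Fintype.card X)
    (hξ0 : ∀ s, ∑ x, (if Φ.f x = s then ξ x else 0) = 0) :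
    ∃ Ψ : BMDP S A X, Ψ.μ = Φ.μ ∧ Ψ.p = Φ.p ∧ Ψ.f = Φ.f ∧
      (∀ s x, (Ψ.q s x).toReal = Φ.perturbedEmission α δ ξ s x) ∧ Ψ.Regular α η ∧
      ∀ s x, |(Ψ.q s x).toReal - (Φ.q s x).toReal| ≤
        (δ * (η ^ 2 * Fintype.card S) + θ) / Fintype.card X := by
  have hδ0 : 0 < δ := by
    by_contra h
    nlinarith
  have hθδ : θ < δ := by nlinarith
  set n : ℝ := (Fintype.card X : ℝ) with hn
  have hunif : ∀ s, 1 / n ≤ 1 / (α s * n) := fun s => by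
    have := mul_pos (hl.1 s) hX
    refine one_div_le_one_div_of_le this ?_
    nlinarith [hl.le_one s]
  have hpos : ∀ x, 0 < Φ.perturbedEmission α δ ξ (Φ.f x) x := fun x => by
    rw [perturbedEmission, if_pos rfl]
    have h1 : 0 ≤ (1 - δ) * (Φ.q (Φ.f x) x).toReal :=
      mul_nonneg (by linarith) ENNReal.toReal_nonneg
    have h2 := (abs_le.1 (hξ x)).1
    have h3 : θ / n < δ / (α (Φ.f x) * n) := by
      calc θ / n < δ / n := by gcongr
        _ = δ * (1 / n) := by ring
        _ ≤ δ * (1 / (α (Φ.f x) * n)) := mul_le_mul_of_nonneg_left (hunif _) hδ0.le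
        _ = _ := by ring
    linarith
  have hzero : ∀ s x, Φ.f x ≠ s → Φ.perturbedEmission α δ ξ s x = 0 := fun s x h => if_neg h
  have hsum : ∀ s, ∑ x, Φ.perturbedEmission α δ ξ s x = 1 := fun s => by
    have h1 : ∀ x, Φ.perturbedEmission α δ ξ s x = (1 - δ) * (Φ.q s x).toReal +
        (if Φ.f x = s then δ / (α s * n) else 0) + (if Φ.f x = s then ξ x else 0) := fun x => by
      unfold perturbedEmission
      split_ifs with h
      · ring
      · simp [Φ.emission_eq_zero h]
    simp_rw [h1, Finset.sum_add_distrib]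
    rw [hξ0, hl.sum_cluster_const, ← Finset.mul_sum, sum_toReal_eq_one,
      mul_div_cancel₀ _ (mul_pos (hl.1 s) hX).ne']
    ring
  obtain ⟨Ψ, hμ, hp, hf, hq⟩ := Φ.exists_of_emission _ hpos hzero hsum
  refine ⟨Ψ, hμ, hp, hf, hq, ⟨hr.1, ?_, ?_⟩, ?_⟩
  · rw [hp]
    exact hr.2.1
  · rw [hf]
    rintro s x y rfl hy
    rw [hq, hq, perturbedEmission, perturbedEmission, if_pos rfl, if_pos hy]
    have h1 := mul_le_mul_of_nonneg_left (hr.2.2 _ x y rfl hy) (sub_nonneg.2 hδ1)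
    have h2 := (abs_le.1 (hξ x)).2
    have h3 := mul_le_mul_of_nonneg_left (abs_le.1 (hξ y)).1 (zero_le_one.trans hη.le)
    have h4 : (1 + η) * (θ / n) ≤ (η - 1) * (δ / (α (Φ.f x) * n)) := by
      have h5 := mul_le_mul_of_nonneg_left (hunif (Φ.f x))
        (mul_nonneg (sub_nonneg.2 hη.le) hδ0.le)
      have h6 := mul_le_mul_of_nonneg_right hδ (one_div_nonneg.2 hX.le)
      calc _ = (1 + η) * θ * (1 / n) := by ring
        _ ≤ _ := h6.trans h5
        _ = _ := by ring
    linarith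
  · intro s x
    rw [hq, perturbedEmission]
    have hη0 : 0 < η := by linarith
    split_ifs with h
    · subst h
      set a := α (Φ.f x) with ha
      have ha0 : 0 < a := hl.1 _
      have h1 := hr.cluster_mul_emission_le hl x
      have h2 := hr.one_le_card_mul hl (Φ.f x)
      set b := (Φ.q (Φ.f x) x).toReal with hb
      have hb0 : 0 < b := Φ.emission_pos x
      have h3 : 1 / (a * n) ≤ η * Fintype.card S / n := by
        rw [div_le_div_iff₀ (mul_pos ha0 hX) hX]
        calc 1 * n ≤ Fintype.card S * (η * a) * n := by gcongr
          _ = _ := by ring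
      have h4 : b ≤ η * (1 / (a * n)) := by
        rw [mul_one_div, le_div_iff₀ (mul_pos ha0 hX)]
        linarith
      have h5 : 0 < 1 / (a * n) := one_div_pos.2 (mul_pos ha0 hX)
      have h6 : |1 / (a * n) - b| ≤ η ^ 2 * Fintype.card S / n := by
        have h7 : η * (1 / (a * n)) ≤ η * (η * Fintype.card S / n) := by gcongr
        have h8 : η * (η * Fintype.card S / n) = η ^ 2 * Fintype.card S / n := by ring
        rw [abs_le]
        constructor <;> nlinarith
      calc |(1 - δ) * b + δ / (a * n) + ξ x - b| = |δ * (1 / (a * n) - b) + ξ x| := by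
            congr 1; ring
        _ ≤ δ * |1 / (a * n) - b| + |ξ x| := by
            refine (abs_add_le _ _).trans ?_
            rw [abs_mul, abs_of_pos hδ0]
        _ ≤ δ * (η ^ 2 * Fintype.card S / n) + θ / n := by
            gcongr
            exact hξ x
        _ = _ := by ring
    · simp only [Φ.emission_eq_zero h, ENNReal.toReal_zero, sub_zero, abs_zero]
      positivity

theorem LinearClusters.exists_pairs {Φ : BMDP S A X} {α : S → ℝ} (hl : Φ.LinearClusters α)
    (m : ℕ) (hm : ∀ s, (2 * m : ℝ) ≤ α s * Fintype.card X) :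
    ∃ e : S × Fin m × Bool → X, e.Injective ∧ ∀ t, Φ.f (e t) = t.1 := by
  classical
  have h : ∀ s, Nonempty (Fin m × Bool ↪ {x // Φ.f x = s}) := fun s => by
    refine Function.Embedding.nonempty_of_card_le ?_
    have h1 := hm s
    rw [← hl.2.2 s] at h1
    have h2 : (Φ.f ⁻¹' {s}).ncard = Fintype.card {x // Φ.f x = s} := by
      rw [← Nat.card_coe_set_eq, Nat.card_eq_fintype_card]
      rfl
    rw [h2] at h1
    have h3 : 2 * m ≤ Fintype.card {x // Φ.f x = s} := by exact_mod_cast h1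
    simpa [mul_comm] using h3
  refine ⟨fun t => ((h t.1).some t.2 : X), ?_, fun t => ((h t.1).some t.2).2⟩
  rintro ⟨s, t⟩ ⟨s', t'⟩ htt
  have hs : s = s' := by
    have h1 := ((h s).some t).2
    have h2 := ((h s').some t').2
    simp only at htt
    rw [htt] at h1
    exact h1.symm.trans h2
  subst hs
  exact congrArg (Prod.mk s) ((h s).some.injective (Subtype.ext htt))

/-- Perturbations of the emissions indexed by sign vectors, such that a single context reward can
be given independent emission means under two weakly correlated sign vectors. -/
theorem exists_perturbed_family (Φ : BMDP S A X) (α : S → ℝ) (η : ℝ) (hη : 1 < η)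
    (hl : Φ.LinearClusters α) (hr : Φ.Regular α η) (hX : (0 : ℝ) < Fintype.card X)
    (θ : ℝ) (hθ : 0 < θ) (hθ1 : θ * ((1 + η) / (η - 1)) ≤ 1) (m : ℕ) (hm0 : 0 < m)
    (hm : ∀ s, (2 * m : ℝ) ≤ α s * Fintype.card X) :
    ∃ (Φ₀ : BMDP S A X) (Ψ : (Fin m → Bool) → BMDP S A X),
      (Φ₀.μ = Φ.μ ∧ Φ₀.p = Φ.p ∧ Φ₀.f = Φ.f ∧ Φ₀.Regular α η) ∧
      (∀ σ, (Ψ σ).μ = Φ.μ ∧ (Ψ σ).p = Φ.p ∧ (Ψ σ).f = Φ.f ∧ (Ψ σ).Regular α η ∧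
        (∀ s x, |((Ψ σ).q s x).toReal - (Φ.q s x).toReal| ≤
          θ * ((1 + η) / (η - 1) * (η ^ 2 * Fintype.card S) + 1) / Fintype.card X) ∧
        ∀ s x, |((Ψ σ).q s x).toReal - (Φ₀.q s x).toReal| ≤ θ / Fintype.card X) ∧
      ∀ σ σ', |∑ j, boolSign (σ j) * boolSign (σ' j)| ≤ (m : ℝ) / 2 →
        ∀ g g' : S → ℝ, (∀ s, |g s| ≤ 2) → (∀ s, |g' s| ≤ 2) →
          ∃ ρ : X → ℝ, (∀ x, ρ x ∈ Set.Icc (0 : ℝ) 1) ∧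
            (∀ s, ∑ y, ((Ψ σ).q s y).toReal * ρ y =
              1 / 2 + θ * m / (16 * Fintype.card X) * g s) ∧
            ∀ s, ∑ y, ((Ψ σ').q s y).toReal * ρ y =
              1 / 2 + θ * m / (16 * Fintype.card X) * g' s := by
  classical
  set δ := θ * ((1 + η) / (η - 1)) with hδdef
  have hη1 : 0 < η - 1 := by linarith
  have hδ : (1 + η) * θ ≤ (η - 1) * δ := by
    rw [hδdef]
    apply le_of_eq
    field_simp
  obtain ⟨e, he, hef⟩ := hl.exists_pairs m hm
  set n : ℝ := (Fintype.card X : ℝ) with hn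
  have hθn : 0 < θ / n := div_pos hθ hX
  -- The same sign `σ j` serves every cluster, so one correlation condition on `σ`, `σ'` handles all
  -- latent states at once.
  set ξ : (Fin m → Bool) → X → ℝ := fun σ => pairFun e fun _ j _ => θ / n * boolSign (σ j)
    with hξdef
  have hξ : ∀ σ x, |ξ σ x| ≤ θ / n := fun σ x =>
    pairFun_induction e _ (fun t => |t| ≤ θ / n) he (by simpa using hθn.le) (fun s j b => by
      rw [abs_mul, abs_mul, abs_boolSign, abs_boolSign, abs_of_pos hθn]
      simp) x
  have hξsum : ∀ σ (F : X → ℝ) s, ∑ x, (if Φ.f x = s then ξ σ x * F x else 0) =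
      θ / n * ∑ j, boolSign (σ j) * (F (e (s, j, true)) - F (e (s, j, false))) := fun σ F s => by
    rw [sum_pairFun_mul he Φ.f hef, Finset.mul_sum]
    exact Finset.sum_congr rfl fun j _ => by ring
  have hξ0 : ∀ σ s, ∑ x, (if Φ.f x = s then ξ σ x else 0) = 0 := fun σ s => by
    have := hξsum σ (fun _ => 1) s
    simpa using this
  have hfam := fun σ => Φ.exists_perturbed α η hη hl hr hX δ θ hθ hθ1 hδ (ξ σ) (hξ σ) (hξ0 σ)
  choose Ψ hΨμ hΨp hΨf hΨq hΨr hΨd using hfam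
  -- The reference model is mixed but not shifted, so its distance to each alternative is `θ/n`,
  -- without the cost of the mixing.
  obtain ⟨Φ₀, h0μ, h0p, h0f, h0q, h0r, -⟩ := Φ.exists_perturbed α η hη hl hr hX δ θ hθ hθ1 hδ 0
    (fun x => by simpa using hθn.le) (fun s => by simp)
  refine ⟨Φ₀, Ψ, ⟨h0μ, h0p, h0f, h0r⟩, fun σ => ⟨hΨμ σ, hΨp σ, hΨf σ, hΨr σ, fun s x => ?_,
    fun s x => ?_⟩, ?_⟩
  · refine (hΨd σ s x).trans (le_of_eq ?_)
    rw [hδdef]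
    ring
  · rw [hΨq, h0q, perturbedEmission, perturbedEmission]
    split_ifs
    · simpa using hξ σ x
    · simpa using hθn.le
  intro σ σ' hσ g g' hg hg'
  have hm' : (0 : ℝ) < m := by exact_mod_cast hm0
  have hscale : ∀ t : ℝ, |t| ≤ 2 → |(m : ℝ) / 4 * t| ≤ (m : ℝ) / 2 := fun t ht => by
    rw [abs_mul, abs_of_pos (by positivity)]
    calc (m : ℝ) / 4 * |t| ≤ m / 4 * 2 := by gcongr
      _ = _ := by ring
  choose τ hτ hτσ hτσ' using fun s => exists_prescribed_correlations hm0 σ σ' hσ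
    ((m : ℝ) / 4 * g s) ((m : ℝ) / 4 * g' s) (hscale _ (hg s)) (hscale _ (hg' s))
  set B : S → Fin m → Bool → ℝ := fun s j b => (Φ₀.q s (e (s, j, b))).toReal with hB
  have hBpos : ∀ s j b, 0 < B s j b := fun s j b => by
    have := Φ₀.emission_pos (e (s, j, b))
    rwa [h0f, hef] at this
  -- Each point is weighted by the reference mass of its partner. The pair then has mean zero under
  -- `Φ₀` (`hbase`), while its two values still differ by `τ/4` (`hdiff`).
  set c : S → Fin m → Bool → ℝ := fun s j b =>
    τ s j * (B s j (!b) / (4 * (B s j true + B s j false))) with hc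
  have hcb : ∀ s j b, |c s j b| ≤ 1 / 2 := fun s j b => by
    have h1 := hBpos s j true
    have h2 := hBpos s j false
    have h3 : |B s j (!b) / (4 * (B s j true + B s j false))| ≤ 1 / 4 := by
      rw [abs_of_pos (div_pos (hBpos _ _ _) (by linarith)), div_le_iff₀ (by linarith)]
      cases b <;> simp only [Bool.not_true, Bool.not_false] <;> linarith
    rw [hc, abs_mul]
    calc _ ≤ 2 * (1 / 4 : ℝ) := mul_le_mul (hτ s j) h3 (abs_nonneg _) (by norm_num)
      _ = _ := by norm_num
  have hρval : ∀ s j b, pairFun e c (e (s, j, b)) = boolSign b * c s j b := fun s j b =>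
    pairFun_apply he c s j b
  have hdiff : ∀ s j, (1 / 2 + pairFun e c (e (s, j, true))) -
      (1 / 2 + pairFun e c (e (s, j, false))) = τ s j / 4 := fun s j => by
    have h1 := hBpos s j true
    have h2 := hBpos s j false
    rw [hρval, hρval]
    simp only [hc, boolSign, Bool.not_true, Bool.not_false, if_true, Bool.false_eq_true, if_false]
    field_simp
    ring
  have hbase : ∀ s, ∑ x, Φ.perturbedEmission α δ 0 s x * (1 / 2 + pairFun e c x) = 1 / 2 := by
    intro s
    simp_rw [← h0q, mul_add, Finset.sum_add_distrib]
    rw [← Finset.sum_mul, sum_toReal_eq_one, one_mul]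
    have h1 : ∀ x, (Φ₀.q s x).toReal * pairFun e c x =
        if Φ.f x = s then pairFun e c x * (Φ₀.q s x).toReal else 0 := fun x => by
      split_ifs with h
      · ring
      · rw [Φ₀.emission_eq_zero (by rwa [h0f])]
        simp
    simp_rw [h1]
    rw [sum_pairFun_mul he Φ.f hef, Finset.sum_eq_zero, add_zero]
    intro j _
    simp only [hc, Bool.not_true, Bool.not_false]
    change τ s j * (B s j false / _) * B s j true - τ s j * (B s j true / _) * B s j false = 0
    ring
  have hmean : ∀ σ s, ∑ x, ((Ψ σ).q s x).toReal * (1 / 2 + pairFun e c x) =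
      1 / 2 + θ / n * ((∑ j, boolSign (σ j) * τ s j) / 4) := fun σ s => by
    simp_rw [hΨq]
    rw [sum_perturbedEmission_mul, hbase, hξsum, Finset.sum_div]
    congr 2
    refine Finset.sum_congr rfl fun j _ => ?_
    rw [hdiff]
    ring
  refine ⟨fun x => 1 / 2 + pairFun e c x, fun x => ?_, fun s => ?_, fun s => ?_⟩
  · have : |pairFun e c x| ≤ 1 / 2 :=
      pairFun_induction e c (fun t => |t| ≤ 1 / 2) he (by simp) (fun s j b => by
        rw [abs_mul, abs_boolSign, one_mul]
        exact hcb s j b) x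
    rw [abs_le] at this
    constructor <;> linarith
  · rw [hmean, hτσ]
    field_simp
    ring
  · rw [hmean, hτσ']
    field_simp
    ring

end BMDP

/-! ### The test function of `Λ` and the conflict between two models -/

namespace BMDP

variable {S A X : Type*}

section Lam

variable [Fintype S] (Φ : BMDP S A X)

theorem sum_p_sub_mul_eq (a b : A) (s : S) (v : S → ℝ) :
    ∑ s', ((Φ.p s a s').toReal - (Φ.p s b s').toReal) * v s' =
      Φ.latentMean v s a - Φ.latentMean v s b := by
  simp only [latentMean, sub_mul, Finset.sum_sub_distrib]

theorem abs_latentMean_le (v : S → ℝ) (hv : ∀ s, |v s| ≤ 1) (s : S) (a : A) :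
    |Φ.latentMean v s a| ≤ 1 :=
  abs_sum_toReal_mul_le _ _ 1 hv

theorem iSup_latentMean_sub_le_two (v : S → ℝ) (hv : ∀ s, |v s| ≤ 1) (s : S) :
    ⨆ a : A × A, ∑ s', ((Φ.p s a.1 s').toReal - (Φ.p s a.2 s').toReal) * v s' ≤ 2 := by
  refine Real.iSup_le (fun a => ?_) zero_le_two
  rw [sum_p_sub_mul_eq]
  have h1 := abs_le.1 (Φ.abs_latentMean_le v hv s a.1)
  have h2 := abs_le.1 (Φ.abs_latentMean_le v hv s a.2)
  linarith

theorem Lam_le_two : Φ.Lam ≤ 2 := by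
  refine Real.iSup_le (fun v => ?_) zero_le_two
  rcases isEmpty_or_nonempty S with hS | hS
  · simp
  have hc : (0 : ℝ) < Fintype.card S := by exact_mod_cast Fintype.card_pos
  rw [one_div_mul_eq_div, div_le_iff₀ hc]
  calc _ ≤ ∑ _s : S, (2 : ℝ) := Finset.sum_le_sum fun s _ =>
        Φ.iSup_latentMean_sub_le_two (fun s => v s) (fun s => abs_le.2 (v s).2) s
    _ = _ := by simp [mul_comm]

/-- A test function reaching half of the supremum is enough, so attainment is not needed. The
extremes `M`, `m` over actions are the optimal one-step means for `v` and, up to sign, for `-v`. -/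
theorem exists_test_function [Fintype A] (h : 0 < Φ.Lam) :
    ∃ v M m : S → ℝ, (∀ s, |v s| ≤ 1) ∧ (∀ s, |M s| ≤ 1) ∧ (∀ s, |m s| ≤ 1) ∧
      (∀ s a, Φ.latentMean v s a ≤ M s) ∧ (∀ s, ∃ a, Φ.latentMean v s a = M s) ∧
      (∀ s a, m s ≤ Φ.latentMean v s a) ∧ (∀ s, ∃ a, Φ.latentMean v s a = m s) ∧
      Φ.Lam / 2 * Fintype.card S ≤ ∑ s, (M s - m s) := by
  have : Nonempty (S → Set.Icc (-1 : ℝ) 1) := ⟨fun _ => ⟨0, by norm_num⟩⟩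
  obtain ⟨v, hv⟩ := exists_lt_of_lt_ciSup (show Φ.Lam / 2 < Φ.Lam by linarith)
  have hA : Nonempty A := by
    by_contra hA
    rw [not_nonempty_iff] at hA
    simp at hv
    linarith
  have hS : Nonempty S := by
    by_contra hS
    rw [not_nonempty_iff] at hS
    simp at hv
    linarith
  have hc : (0 : ℝ) < Fintype.card S := by exact_mod_cast Fintype.card_pos
  choose aM haM using fun s => Finite.exists_max fun a : A => Φ.latentMean (fun s => v s) s a
  choose am ham using fun s => Finite.exists_min fun a : A => Φ.latentMean (fun s => v s) s a
  have hv1 : ∀ s, |(v s : ℝ)| ≤ 1 := fun s => abs_le.2 (v s).2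
  refine ⟨fun s => v s, fun s => Φ.latentMean (fun s => v s) s (aM s),
    fun s => Φ.latentMean (fun s => v s) s (am s), hv1,
    fun s => Φ.abs_latentMean_le _ hv1 _ _, fun s => Φ.abs_latentMean_le _ hv1 _ _,
    haM, fun s => ⟨_, rfl⟩, ham, fun s => ⟨_, rfl⟩, ?_⟩
  rw [one_div_mul_eq_div, lt_div_iff₀ hc] at hv
  refine hv.le.trans (Finset.sum_le_sum fun s _ => ciSup_le fun a => ?_)
  have := Φ.sum_p_sub_mul_eq a.1 a.2 s fun s => v s
  rw [this]
  exact sub_le_sub (haM s a.1) (ham s a.2)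

end Lam

theorem LinearClusters.sum_comp [Fintype S] [Fintype X] {Φ : BMDP S A X} {α : S → ℝ}
    (hl : Φ.LinearClusters α) (F : S → ℝ) :
    ∑ x, F (Φ.f x) = ∑ s, α s * Fintype.card X * F s := by
  classical
  simp_rw [← hl.sum_cluster_const]
  rw [Finset.sum_comm]
  simp

/-- Regular transitions charge every context, so only the initial law can vanish, and the two models
share it. -/
theorem Regular.nextContext_eq_zero [Fintype S] [Fintype X] {Φ : BMDP S A X} {α : S → ℝ} {η : ℝ}
    (hη : 0 < η) (hr : Φ.Regular α η) (hl : Φ.LinearClusters α) (Ψ : BMDP S A X)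
    (hμ : Ψ.μ = Φ.μ) (H : ℕ) (w : List (X × A)) (x : X) (h : Φ.nextContext H w x = 0) :
    Ψ.nextContext H w x = 0 := by
  cases w with
  | nil => rw [nextContext] at h ⊢; rwa [hμ]
  | cons z w =>
    simp only [nextContext] at h ⊢
    split_ifs at h ⊢
    · rwa [hμ]
    · have h1 := hr.le_step hη hl z.1 z.2 x
      have hS : (0 : ℝ) < Fintype.card S := by exact_mod_cast Fintype.card_pos_iff.2 ⟨Φ.f x⟩
      have hX : (0 : ℝ) < Fintype.card X := by exact_mod_cast Fintype.card_pos_iff.2 ⟨x⟩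
      rw [h, ENNReal.toReal_zero] at h1
      exact absurd h1 (not_le.2 (by positivity))

/-- If a single context reward can be given independent emission means of size `ζ` under `Ψ` and
`Ψ'`, then no output is near-optimal for both, unless `ζ` is of order `ε`. -/
theorem not_nearOptimal_both [Fintype S] [Fintype A] [Fintype X] (Φ Ψ Ψ' : BMDP S A X)
    (α : S → ℝ) (η : ℝ) (hη : 1 < η) (hl : Φ.LinearClusters α) (hu : Φ.UniformInit)
    (hX : (0 : ℝ) < Fintype.card X) (hΛ : 0 < Φ.Lam)
    (hμ : Ψ.μ = Φ.μ) (hp : Ψ.p = Φ.p) (hf : Ψ.f = Φ.f) (hr : Ψ.Regular α η)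
    (hμ' : Ψ'.μ = Φ.μ) (hp' : Ψ'.p = Φ.p) (hf' : Ψ'.f = Φ.f) (hr' : Ψ'.Regular α η)
    (ζ : ℝ) (hζ : 0 ≤ ζ)
    (hsep : ∀ g g' : S → ℝ, (∀ s, |g s| ≤ 2) → (∀ s, |g' s| ≤ 2) →
      ∃ ρ : X → ℝ, (∀ x, ρ x ∈ Set.Icc (0 : ℝ) 1) ∧
        (∀ s, ∑ y, (Ψ.q s y).toReal * ρ y = 1 / 2 + ζ * g s) ∧
        ∀ s, ∑ y, (Ψ'.q s y).toReal * ρ y = 1 / 2 + ζ * g' s)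
    (H : ℕ) (hH : 2 ≤ H) (pol : Reward A X H → Policy A X H) (ε : ℝ)
    (h : Ψ.UniformlyNearOptimal pol ε) (h' : Ψ'.UniformlyNearOptimal pol ε) :
    ζ * Φ.Lam ≤ 8 * η ^ 3 * Fintype.card S * ε := by
  obtain ⟨K, rfl⟩ := Nat.exists_eq_add_of_le' hH
  obtain ⟨v, M, m, hv, hM1, hm1, hM, hMa, hm, hma, hsum⟩ := Φ.exists_test_function hΛ
  have hl1 : Ψ.LinearClusters α := by rw [LinearClusters, hf]; exact hl
  have hl2 : Ψ'.LinearClusters α := by rw [LinearClusters, hf']; exact hl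
  have hη0 : 0 < η := by linarith
  have hb : ∀ (u U : S → ℝ), (∀ s, |u s| ≤ 1) → (∀ s, |U s| ≤ 1) → ∀ (i : Fin (K + 1)) s,
      |u s - if (i : ℕ) < K then U s else 0| ≤ 2 := fun u U hu hU i s => by
    have h1 := abs_le.1 (hu s)
    have h2 := abs_le.1 (hU s)
    rw [abs_le]
    split_ifs <;> constructor <;> linarith
  have hv' : ∀ s, |(-v) s| ≤ 1 := fun s => by simpa using hv s
  have hm1' : ∀ s, |(-m) s| ≤ 1 := fun s => by simpa using hm1 s
  -- One reward for both models: `v` with maximum `M` under `Ψ`, and `-v` with maximum `-m` under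
  -- `Ψ'`.
  choose ρ hρ1 hρ hρ' using fun i => hsep _ _ (hb v M hv hM1 i) (hb (-v) (-m) hv' hm1' i)
  set ρ₀ : Fin (K + 2) → X → ℝ := Fin.cons 0 ρ with hρ₀
  have hρ₀1 : ∀ h x, ρ₀ h x ∈ Set.Icc (0 : ℝ) 1 := fun h x => by
    refine Fin.cases ?_ (fun i => ?_) h
    · simp [hρ₀]
    · simpa [hρ₀] using hρ1 i x
  set r : Reward A X (K + 2) := fun h x _ => ⟨ρ₀ h x, hρ₀1 h x⟩
  set κ : ℝ := 1 / (η ^ 2 * Fintype.card S * Fintype.card X) with hκ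
  obtain ⟨x₀⟩ : Nonempty X := Fintype.card_pos_iff.1 (by exact_mod_cast hX)
  have hS1 : (1 : ℝ) ≤ Fintype.card S := by
    exact_mod_cast Fintype.card_pos_iff.2 ⟨Φ.f x₀⟩
  have hκμ : ∀ x, κ ≤ (Φ.μ x).toReal := fun x => by
    rw [hu x, hκ]
    refine one_div_le_one_div_of_le hX ?_
    have h1 : 1 ≤ η ^ 2 * Fintype.card S := by nlinarith
    nlinarith
  have hlm : ∀ s a, Φ.latentMean (-v) s a = -Φ.latentMean v s a := fun s a => by
    simp [latentMean]
  have hlmΨ : Ψ.latentMean = Φ.latentMean := by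
    funext W s a
    rw [latentMean, latentMean, hp]
  have hlmΨ' : Ψ'.latentMean = Φ.latentMean := by
    funext W s a
    rw [latentMean, latentMean, hp']
  have g1 := Ψ.gaps_le_suboptimality K (pol r) r ρ₀ (fun _ _ _ => rfl) (fun x => rfl) ζ hζ v M
    (fun i s => hρ i s) (by rwa [hlmΨ]) (by rwa [hlmΨ]) κ (by rwa [hμ]) (hr.le_step hη0 hl1)
  have g2 := Ψ'.gaps_le_suboptimality K (pol r) r ρ₀ (fun _ _ _ => rfl) (fun x => rfl) ζ hζ
    (-v) (-m) (fun i s => hρ' i s)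
    (fun s a => by rw [hlmΨ', hlm]; exact neg_le_neg (hm s a))
    (fun s => by
      obtain ⟨a, ha⟩ := hma s
      exact ⟨a, by rw [hlmΨ', hlm, ha]; rfl⟩) κ (by rwa [hμ']) (hr'.le_step hη0 hl2)
  rw [hlmΨ, hf] at g1
  rw [hlmΨ', hf'] at g2
  -- The gaps `M - latentMean v` and `latentMean v - m` add up to `M - m` for every action, so the
  -- policy drops out.
  have hcomb : ∑ i : Fin (K + 1), ∑ x, ∑ a, (pol r i.castSucc x a).toReal *
        (M (Φ.f x) - Φ.latentMean v (Φ.f x) a) +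
      ∑ i : Fin (K + 1), ∑ x, ∑ a, (pol r i.castSucc x a).toReal *
        ((-m) (Φ.f x) - Φ.latentMean (-v) (Φ.f x) a) =
      (K + 1) * ∑ x, (M (Φ.f x) - m (Φ.f x)) := by
    rw [← Finset.sum_add_distrib]
    have h1 : ∀ i : Fin (K + 1), (∑ x, ∑ a, (pol r i.castSucc x a).toReal *
        (M (Φ.f x) - Φ.latentMean v (Φ.f x) a) +
      ∑ x, ∑ a, (pol r i.castSucc x a).toReal *
        ((-m) (Φ.f x) - Φ.latentMean (-v) (Φ.f x) a)) = ∑ x, (M (Φ.f x) - m (Φ.f x)) := by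
      intro i
      rw [← Finset.sum_add_distrib]
      refine Finset.sum_congr rfl fun x _ => ?_
      rw [← Finset.sum_add_distrib]
      calc _ = ∑ a, (pol r i.castSucc x a).toReal * (M (Φ.f x) - m (Φ.f x)) := by
            refine Finset.sum_congr rfl fun a _ => ?_
            rw [hlm, Pi.neg_apply]
            ring
        _ = _ := by rw [← Finset.sum_mul, sum_toReal_eq_one, one_mul]
    rw [Finset.sum_congr rfl fun i _ => h1 i, Finset.sum_const, Finset.card_univ, Fintype.card_fin,
      nsmul_eq_mul]
    push_cast
    rfl
  have hgapsum : Fintype.card X / (η * Fintype.card S) * (Φ.Lam / 2 * Fintype.card S) ≤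
      ∑ x, (M (Φ.f x) - m (Φ.f x)) := by
    rw [hl.sum_comp fun s => M s - m s]
    refine (mul_le_mul_of_nonneg_left hsum (by positivity)).trans ?_
    rw [Finset.mul_sum]
    refine Finset.sum_le_sum fun s _ => mul_le_mul_of_nonneg_right ?_ ?_
    · rw [div_le_iff₀ (by positivity)]
      have h1 := mul_le_mul_of_nonneg_left (hr.one_le_card_mul hl1 s) hX.le
      linarith
    · obtain ⟨a, ha⟩ := hMa s
      linarith [hm s a]
  have s1 := h r
  have s2 := h' r
  have hK : (0 : ℝ) < ((K + 2 : ℕ) : ℝ) := by positivity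
  rw [one_div_mul_eq_div, div_le_iff₀ hK] at s1 s2
  have t1 : ζ * (κ * ((K + 1) * (Fintype.card X / (η * Fintype.card S) *
      (Φ.Lam / 2 * Fintype.card S)))) ≤ 2 * (ε * ((K + 2 : ℕ) : ℝ)) := by
    calc _ ≤ ζ * (κ * ((K + 1) * ∑ x, (M (Φ.f x) - m (Φ.f x)))) := by gcongr
      _ ≤ 2 * (ε * ((K + 2 : ℕ) : ℝ)) := by
        rw [← hcomb, mul_add, mul_add]
        linarith
  have t2 : ζ * (κ * ((K + 1) * (Fintype.card X / (η * Fintype.card S) *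
      (Φ.Lam / 2 * Fintype.card S)))) = ζ * Φ.Lam * (K + 1) / (2 * η ^ 3 * Fintype.card S) := by
    rw [hκ]
    field_simp
  have hε : 0 ≤ ε := by
    have h1 := Ψ.value_le_optValue (pol r) r
    by_contra hε
    nlinarith
  rw [t2, div_le_iff₀ (by positivity)] at t1
  have hK1 : (0 : ℝ) < K + 1 := by positivity
  refine le_of_mul_le_mul_right (t1.trans ?_) hK1
  -- Gaps accumulate over `H - 1` stages while regret is normalized by `H`; `H ≥ 2` makes this a
  -- factor `2`.
  have h1 : ((K + 2 : ℕ) : ℝ) ≤ 2 * (K + 1) := by push_cast; linarith [(Nat.cast_nonneg K : (0:ℝ) ≤ K)]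
  calc 2 * (ε * ((K + 2 : ℕ) : ℝ)) * (2 * η ^ 3 * Fintype.card S)
      ≤ 2 * (ε * (2 * (K + 1))) * (2 * η ^ 3 * Fintype.card S) := by gcongr
    _ = _ := by ring

end BMDP

/-! ### Counting the distinguishable hypotheses -/

/-- A family of events, any two of which are disjoint unless their indices are related, has total
mass at most the number of indices related to a given one. -/
theorem sum_measure_le_of_card_le {ι Ω : Type*} [Fintype ι] [MeasurableSpace Ω]
    (ν : MeasureTheory.Measure Ω) [MeasureTheory.IsProbabilityMeasure ν] (E : ι → Set Ω)
    (hE : ∀ i, MeasurableSet (E i)) (R : ι → ι → Prop) [DecidableRel R] (B : ℝ≥0∞)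
    (hR : ∀ i j ω, ω ∈ E i → ω ∈ E j → R i j)
    (hB : ∀ i, ((Finset.univ.filter fun j => R i j).card : ℝ≥0∞) ≤ B) :
    ∑ i, ν (E i) ≤ B := by
  classical
  calc ∑ i, ν (E i) = ∑ i, ∫⁻ ω, (E i).indicator 1 ω ∂ν := by
        simp_rw [MeasureTheory.lintegral_indicator_one (hE _)]
    _ = ∫⁻ ω, ∑ i, (E i).indicator 1 ω ∂ν :=
        (MeasureTheory.lintegral_finsetSum _ fun i _ =>
          (measurable_one.indicator (hE i))).symm
    _ ≤ ∫⁻ _, B ∂ν := by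
        refine MeasureTheory.lintegral_mono fun ω => ?_
        have h1 : ∑ i, (E i).indicator (1 : Ω → ℝ≥0∞) ω =
            ((Finset.univ.filter fun i => ω ∈ E i).card : ℝ≥0∞) := by
          simp [Set.indicator_apply]
        rw [h1]
        by_cases h : ∃ i, ω ∈ E i
        · obtain ⟨i, hi⟩ := h
          refine le_trans ?_ (hB i)
          gcongr with j hj
          exact hR i j ω hi
        · push Not at h
          simp [h]
    _ = B := by simp

/-- The number of hypotheses that a learner distinguishes is bounded by the chi-square
information in its data. -/
theorem Learner.exp_le_of_guarantees {S A X Ω : Type*} [Fintype S] [Fintype A] [Fintype X]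
    [MeasurableSpace Ω] {H : ℕ} (L : Learner A X Ω H) {m : ℕ} (Φ₀ : BMDP S A X)
    (Ψ : (Fin m → Bool) → BMDP S A X) (T : ℕ) (ε C : ℝ) (hC : 1 ≤ C)
    (hac : ∀ σ w x, Φ₀.nextContext H w x = 0 → (Ψ σ).nextContext H w x = 0)
    (hchi : ∀ σ w, ∑' x, Φ₀.nextContext H w x *
      ((Ψ σ).nextContext H w x / Φ₀.nextContext H w x) ^ 2 ≤ ENNReal.ofReal C)
    (hG : ∀ σ, L.Guarantees (Ψ σ) T ε)
    (hsep : ∀ σ σ' (pol : Reward A X H → Policy A X H),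
      (Ψ σ).UniformlyNearOptimal pol ε → (Ψ σ').UniformlyNearOptimal pol ε →
      (m : ℝ) / 2 < |∑ j, boolSign (σ j) * boolSign (σ' j)|) :
    Real.exp (m / 8) ≤ 8 * C ^ (T * H) := by
  classical
  choose E hEm hEo hEp using hG
  set B : ℝ := 2 * (2 ^ m * Real.exp (-(m / 8 : ℝ))) with hBdef
  have hB0 : 0 ≤ B := by positivity
  have hone : ∀ σ, 1 ≤ 4 * ENNReal.ofReal C ^ (T * H) * ∑' w,
      Φ₀.dataLaw H L.explore (T * H) w * (L.seed w : MeasureTheory.Measure Ω) (E σ w) := fun σ =>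
    BMDP.one_le_of_half_le_dataLaw (Ψ σ) Φ₀ H L.explore (hac σ) _
      (by simpa using ENNReal.ofReal_le_ofReal hC) ENNReal.ofReal_ne_top (hchi σ) _ _
      (fun w => MeasureTheory.prob_le_one) (hEp σ)
  have hsum : ∀ w, ∑ σ, (L.seed w : MeasureTheory.Measure Ω) (E σ w) ≤ ENNReal.ofReal B := fun w =>
    sum_measure_le_of_card_le _ (fun σ => E σ w) (fun σ => hEm σ w)
      (fun σ σ' => (m : ℝ) / 2 < |∑ j, boolSign (σ j) * boolSign (σ' j)|) _
      (fun σ σ' ω h h' => hsep σ σ' _ (hEo σ w ω h) (hEo σ' w ω h')) (fun σ => by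
        rw [← ENNReal.ofReal_natCast]
        exact ENNReal.ofReal_le_ofReal (card_correlated_le σ))
  -- Summing the lower bounds over all `2 ^ m` sign vectors and exchanging sums, at most `B` of them
  -- share success for each data set, on average over the seed.
  have htotal : (2 : ℝ≥0∞) ^ m ≤ 4 * ENNReal.ofReal C ^ (T * H) * ENNReal.ofReal B := by
    calc (2 : ℝ≥0∞) ^ m = ∑ _σ : Fin m → Bool, 1 := by simp
      _ ≤ ∑ σ, 4 * ENNReal.ofReal C ^ (T * H) * ∑' w,
          Φ₀.dataLaw H L.explore (T * H) w * (L.seed w : MeasureTheory.Measure Ω) (E σ w) :=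
        Finset.sum_le_sum fun σ _ => hone σ
      _ = 4 * ENNReal.ofReal C ^ (T * H) * ∑' w, Φ₀.dataLaw H L.explore (T * H) w *
          ∑ σ, (L.seed w : MeasureTheory.Measure Ω) (E σ w) := by
        rw [← Finset.mul_sum]
        congr 1
        rw [← tsum_fintype (L := .unconditional _), ENNReal.tsum_comm]
        simp_rw [tsum_fintype, Finset.mul_sum]
      _ ≤ 4 * ENNReal.ofReal C ^ (T * H) * ∑' w, Φ₀.dataLaw H L.explore (T * H) w *
          ENNReal.ofReal B := by
        gcongr with w
        exact hsum w
      _ = _ := by rw [ENNReal.tsum_mul_right, PMF.tsum_coe, one_mul]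
  have hreal : (2 : ℝ) ^ m ≤ 4 * C ^ (T * H) * B := by
    have h1 : (2 : ℝ≥0∞) ^ m = ENNReal.ofReal (2 ^ m) := by
      rw [ENNReal.ofReal_pow zero_le_two]
      simp
    have h2 : 4 * ENNReal.ofReal C ^ (T * H) * ENNReal.ofReal B =
        ENNReal.ofReal (4 * C ^ (T * H) * B) := by
      rw [ENNReal.ofReal_mul (p := 4 * C ^ (T * H)) (by positivity),
        ENNReal.ofReal_mul (p := 4) (by norm_num),
        ENNReal.ofReal_pow (by linarith), ENNReal.ofReal_ofNat]
    rw [h1, h2] at htotal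
    exact (ENNReal.ofReal_le_ofReal_iff (by positivity)).1 htotal
  have h2m : (0 : ℝ) < 2 ^ m := by positivity
  rw [hBdef, Real.exp_neg] at hreal
  have hexp := Real.exp_pos ((m : ℝ) / 8)
  have h3 : 4 * C ^ (T * H) * (2 * (2 ^ m * (Real.exp ((m : ℝ) / 8))⁻¹)) * Real.exp ((m : ℝ) / 8) =
      2 ^ m * (8 * C ^ (T * H)) := by
    field_simp
    ring
  have h4 := mul_le_mul_of_nonneg_right hreal hexp.le
  rw [h3] at h4
  exact le_of_mul_le_mul_left h4 h2m

/-! ### Choice of constants and conclusion -/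

theorem theorem2 (S A : ℕ) (η lam : ℝ) (hη : 1 < η) (hlam : 0 < lam) :
    ∃ c > (0 : ℝ), ∃ K > (0 : ℝ), ∃ ε₀ > (0 : ℝ), ∃ n₀ : ℕ,
      ∀ n ≥ n₀, ∀ (Φ : BMDP (Fin S) (Fin A) (Fin n)) (α : Fin S → ℝ),
        Φ.LinearClusters α → Φ.Regular α η → Φ.UniformInit → lam ≤ Φ.Lam →
        ∀ (H T : ℕ), 2 ≤ H → ∀ ε : ℝ, 0 < ε → ε ≤ ε₀ →
        ∀ (Ω : Type*) [MeasurableSpace Ω] (L : Learner (Fin A) (Fin n) Ω H),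
          (∀ Ψ : BMDP (Fin S) (Fin A) (Fin n),
            Ψ.p = Φ.p → Ψ.f = Φ.f → Ψ.UniformInit → Ψ.Regular α η →
            (∀ s x, |(Ψ.q s x).toReal - (Φ.q s x).toReal| ≤ K * ε / n) →
            L.Guarantees Ψ T ε) →
          c * (n * Φ.Lam / ε ^ 2) ≤ (T : ℝ) * H := by
  rcases Nat.eq_zero_or_pos S with rfl | hS
  · refine ⟨1, one_pos, 1, one_pos, 1, one_pos, 0, fun n _ Φ α hl => ?_⟩
    have := hl.2.1
    simp at this
  have hS0 : (0 : ℝ) < S := by exact_mod_cast hS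
  have hη0 : 0 < η := by linarith
  have hη1 : 0 < η - 1 := by linarith
  -- Incompatibility (`hζ`) needs `κ > 512 η⁴ S² / lam`; `513` makes it strict.
  set κ : ℝ := 513 * η ^ 4 * S ^ 2 / lam with hκ
  have hκ0 : 0 < κ := by positivity
  -- The bound on `ε` keeps the mixing weight at most `1`, and the bound on `n` gives `m ≥ 128`.
  refine ⟨1 / (128 * η ^ 2 * S * κ ^ 2), by positivity,
    κ * ((1 + η) / (η - 1) * (η ^ 2 * S) + 1), by positivity,
    (η - 1) / ((1 + η) * κ), by positivity, ⌈512 * η * S⌉₊, ?_⟩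
  intro n hn Φ α hl hr hu hΛ H T hH ε hε hε1 Ω _ L hG
  have hn' : 512 * η * S ≤ n := (Nat.le_ceil _).trans (by exact_mod_cast hn)
  have hn0 : (0 : ℝ) < n := lt_of_lt_of_le (by positivity) hn'
  have hX : (0 : ℝ) < Fintype.card (Fin n) := by simpa using hn0
  set θ : ℝ := κ * ε with hθ
  have hθ0 : 0 < θ := by positivity
  have hθ1 : θ * ((1 + η) / (η - 1)) ≤ 1 := by
    calc θ * ((1 + η) / (η - 1)) ≤ κ * ((η - 1) / ((1 + η) * κ)) * ((1 + η) / (η - 1)) := by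
          rw [hθ]; gcongr
      _ = 1 := by field_simp
  -- Every cluster has at least `n / (η S)` contexts, and each pair uses two.
  set m : ℕ := ⌊(n : ℝ) / (2 * η * S)⌋₊ with hm
  have hmle : (m : ℝ) ≤ n / (2 * η * S) := Nat.floor_le (by positivity)
  have hmlt : (n : ℝ) / (2 * η * S) < m + 1 := Nat.lt_floor_add_one _
  have hq : (n : ℝ) / (2 * η * S) = 2 * (n / (4 * η * S)) := by field_simp; norm_num
  have hq' : 128 ≤ (n : ℝ) / (4 * η * S) := by
    rw [le_div_iff₀ (by positivity)]
    linarith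
  have hm4 : (n : ℝ) / (4 * η * S) ≤ m := by linarith
  have hm128 : (128 : ℝ) ≤ m := hq'.trans hm4
  have hm0 : 0 < m := by
    have : (0 : ℝ) < m := by linarith
    exact_mod_cast this
  have hmα : ∀ s, (2 * m : ℝ) ≤ α s * Fintype.card (Fin n) := fun s => by
    have h1 := hr.one_le_card_mul hl s
    rw [Fintype.card_fin] at h1 ⊢
    have h2 : (2 * m : ℝ) ≤ n / (η * S) := by
      calc (2 * m : ℝ) ≤ 2 * (n / (2 * η * S)) := by gcongr
        _ = _ := by field_simp
    refine h2.trans ?_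
    rw [div_le_iff₀ (by positivity)]
    have h3 := mul_le_mul_of_nonneg_left h1 hn0.le
    linarith
  obtain ⟨Φ₀, Ψ, ⟨h0μ, h0p, h0f, h0r⟩, hΨ, hsep⟩ :=
    Φ.exists_perturbed_family α η hη hl hr hX θ hθ0 hθ1 m hm0 hmα
  simp only [Fintype.card_fin] at hΨ hsep
  have hl0 : Φ₀.LinearClusters α := by rw [BMDP.LinearClusters, h0f]; exact hl
  have hΛ0 : 0 < Φ.Lam := hlam.trans_le hΛ
  have hζ : 8 * η ^ 3 * S * ε < θ * m / (16 * n) * Φ.Lam := by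
    calc 8 * η ^ 3 * S * ε = 512 * η ^ 4 * S ^ 2 / lam * ε * (1 / (64 * η * S)) * lam := by
          field_simp; norm_num
      _ < κ * ε * (1 / (64 * η * S)) * lam := by
          rw [hκ]
          gcongr
          norm_num
      _ = θ * (n / (4 * η * S)) / (16 * n) * lam := by rw [hθ]; field_simp; norm_num
      _ ≤ _ := by gcongr
  have hexp := L.exp_le_of_guarantees Φ₀ Ψ T ε (1 + η * θ ^ 2)
    (by nlinarith [mul_pos hη0 (pow_pos hθ0 2)])
    (fun σ => h0r.nextContext_eq_zero hη0 hl0 (Ψ σ) ((hΨ σ).1.trans h0μ.symm) H)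
    (fun σ => by
      obtain ⟨h1, h2, h3, -, -, h4⟩ := hΨ σ
      exact h0r.tsum_nextContext_le hη0 hl0 (Ψ σ) (h1.trans h0μ.symm) (h2.trans h0p.symm)
        (h3.trans h0f.symm) θ (by simpa using h4) H)
    (fun σ => by
      obtain ⟨h1, h2, h3, h4, h5, -⟩ := hΨ σ
      refine hG (Ψ σ) h2 h3 (fun x => by rw [h1]; exact hu x) h4 fun s x => (h5 s x).trans_eq ?_
      rw [hθ]
      ring)
    (fun σ σ' pol hσ hσ' => by
      by_contra hcorr
      obtain ⟨h1, h2, h3, h4, -, -⟩ := hΨ σ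
      obtain ⟨h1', h2', h3', h4', -, -⟩ := hΨ σ'
      have := Φ.not_nearOptimal_both (Ψ σ) (Ψ σ') α η hη hl hu hX hΛ0 h1 h2 h3 h4 h1' h2' h3' h4'
        (θ * m / (16 * n)) (by positivity) (hsep σ σ' (not_lt.1 hcorr)) H hH pol ε hσ hσ'
      rw [Fintype.card_fin] at this
      linarith)
  have hinfo : (m : ℝ) / 16 ≤ T * H * (η * θ ^ 2) := by
    have h1 : (1 + η * θ ^ 2) ^ (T * H) ≤ Real.exp (T * H * (η * θ ^ 2)) := by
      calc (1 + η * θ ^ 2) ^ (T * H) ≤ Real.exp (η * θ ^ 2) ^ (T * H) := by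
            gcongr
            linarith [Real.add_one_le_exp (η * θ ^ 2)]
        _ = _ := by rw [← Real.exp_nat_mul]; push_cast; rfl
    -- Half of the exponent `m/8` absorbs the prefactor `8`; this is where `m ≥ 128` enters.
    have h2 : (8 : ℝ) ≤ Real.exp (m / 16) := by
      have := Real.add_one_le_exp ((m : ℝ) / 16)
      linarith
    have h3 : Real.exp ((m : ℝ) / 8) ≤ Real.exp (m / 16 + T * H * (η * θ ^ 2)) := by
      rw [Real.exp_add]
      exact hexp.trans (mul_le_mul h2 h1 (by positivity) (Real.exp_pos _).le)
    have h4 := Real.exp_le_exp.1 h3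
    linarith
  have hTH : (n : ℝ) / (64 * η ^ 2 * S * κ ^ 2 * ε ^ 2) ≤ T * H := by
    rw [div_le_iff₀ (by positivity)]
    have h1 : (n : ℝ) / (4 * η * S) / 16 ≤ T * H * (η * θ ^ 2) :=
      (div_le_div_of_nonneg_right hm4 (by norm_num)).trans hinfo
    rw [div_div, div_le_iff₀ (by positivity), hθ] at h1
    linarith
  refine le_trans ?_ hTH
  calc 1 / (128 * η ^ 2 * S * κ ^ 2) * (n * Φ.Lam / ε ^ 2)
      ≤ 1 / (128 * η ^ 2 * S * κ ^ 2) * (n * 2 / ε ^ 2) := by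
        gcongr
        exact Φ.Lam_le_two
    _ = _ := by field_simp; norm_num
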